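/- **Setting.** A multi-objective graph is a finite directed graph $G=(V,E)$ (edges are ordered pairs of nodes) in which every edge $e$ carries $W\ge 1$ non-negative values $w_e[1],\dots,w_e[W]$. Fix a start node $s$ from which every node can be reached, and $K\ge 1$ coefficient vectors $\lambda_1,\dots,\lambda_K\in\mathbb R^W$ with positive entries. A path is a list of nodes starting with $s$, consecutive ones joined by edges (loops are allowed); its value in objective $j$ is the sum of $w_e[j]$ over its edges, and $Cost(p,\lambda)=\sum_{e\in p}\sum_j \lambda[j]w_e[j]$. A path to $v$ is optimal for $\lambda$ if no path to $v$ has smaller cost. A path dominates another if it is at most as large in all objectives and smaller in at least one; a Pareto path to $v$ is a path to $v$ that no path to $v$ dominates. An $l$-node is a node at the end of at most $l$ different Pareto paths, $\alpha(l)$ is the fraction of nodes that are $l$-nodes, and $L$ is the least $l\in\mathbb N$ with $\alpha(l)\ge 1-\log|V|/|V|$ ($\log$ is the natural logarithm; such an $l$ is assumed to exist). **The algorithm IDAQ.** It keeps a queue of paths, initially only $(s)$, and a list $optimal\_paths$, initially empty. It also has, for each node $v$, a sample path to $v$ that is optimal for $\lambda_1$ (found by Dijkstra's algorithm). In iteration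 $i$ the priority of a path $p$ in the queue is $Cost(p,\lambda_i)$, or null if there is another path $b$ with the same end such that (a) $b$ is in the queue or was popped earlier, and is cheaper for $\lambda_i$; (b) $b$ is in the queue, was pushed before $p$, and has equal cost; or (c) $b$ was popped earlier and has equal cost. The paths of non-null priority are kept in a Fibonacci heap keyed by cost. While this heap is non-empty, IDAQ pops a path $p$ of minimal priority (one says that $p$ is *developed*), appends it to $optimal\_paths$, and scans each extension $q$ of $p$ by an edge. Let $v$ be the end of $q$ and let $Q_v$ be the set of paths to $v$ in the queue or in $optimal\_paths$. If the sample path to $v$ dominates $q$, then $q$ is discarded. Otherwise: * if $|Q_v|<K/W$: $q$ is discarded if some path of $Q_v$ dominates it; otherwise the paths of $Q_v$ dominated by $q$ are removed from the queue and from $optimal\_paths$, and $q$ is pushed to the queue; * if $|Q_v|\ge K/W$: let $best_v[j]\in Q_v$ be of minimal cost for $\lambda_j$ ($j=1,\dots,K$). If $q$ is not strictly cheaper than $best_v[j]$ for any $\lambda_j$, it is discarded; otherwise each $best_v[j]$ than which $q$ is strictly cheaper for $\lambda_j$ is replaced by $q$, the paths of $Q_v$ that are no longer among the $best_v[j]$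 are removed from the queue and from $optimal\_paths$, and $q$ is pushed to the queue. When the heap is empty and $i<K$, iteration $i+1$ begins with a new heap of the paths with non-null priority for $\lambda_{i+1}$; when it is empty and $i=K$, the search ends. Sample paths, ties in $best_v$, and the order in which neighbors are scanned are arbitrary. **Time.** The time spent developing paths is the sum, over all developed paths, of the amortized number of elementary steps of the extraction of the minimum from the Fibonacci heap, plus one step for the insertion into $optimal\_paths$. Amortized means: the actual number of steps plus the increase of the standard potential, $2\,(\#\text{trees}+2\,\#\text{marked nodes})$. **Theorem.** For every constant $c_K$ there is a constant $C>0$, depending only on $c_K$, such that for every instance as above with $K\le c_K\sqrt{|V|}$, at every moment of every execution of IDAQ (in particular at its end): 1. the number of paths developed, counted with repetitions, is at most $C\cdot L\cdot|V|$; 2. if $|V|\ge2$, the time spent developing paths is at most $C\cdot L\cdot|V|\cdot\log|V|$; 3. if $|V|\ge 2$ and $L\le c_F\,F(|V|)$ for a function $F$ and a constant $c_F$, this time is at most $C\,c_F\cdot F(|V|)\cdot|V|\cdot\log|V|$. That is, IDAQ develops $O(L\cdot|V|)$ paths, in total time $O(L\cdot|V|\cdot\log|V|)=O(F(|V|)\cdot|V|\cdot\log|V|)$.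 -/

import Mathlib

/-! ## Fibonacci heaps with step counts -/

/-- A forest of marked trees, i.e. a list of trees: `cons a m c r` is the tree with root `a`,
mark `m` and list of children `c` (the most recently linked child first), followed by the
trees of `r`. A Fibonacci heap is such a forest, its trees being the heap-ordered root list. -/
inductive FibForest (α : Type*) where
  | nil : FibForest α
  | cons (a : α) (marked : Bool) (children rest : FibForest α) : FibForest α

namespace FibForest

variable {α β : Type*}

/-- The number of trees of a forest. The rank of a node is the `length` of its children. -/
def length : FibForest α → ℕ
  | nil => 0
  | cons _ _ _ r => r.length + 1

/-- The number of marked nodes. -/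
def marks : FibForest α → ℕ
  | nil => 0
  | cons _ m c r => (if m then 1 else 0) + c.marks + r.marks

/-- Concatenation of two lists of trees. -/
def append : FibForest α → FibForest α → FibForest α
  | nil, g => g
  | cons a m c r, g => cons a m c (r.append g)

/-- The largest rank of a root (`0` for the empty forest). -/
def maxRank : FibForest α → ℕ
  | nil => 0
  | cons _ _ c r => max c.length r.maxRank

/-- The potential of a Fibonacci heap, "number of trees plus twice the number of marked nodes",
in a unit of two elementary steps (a root that takes part in a consolidation is charged one step
when it is visited and one when it is linked). It is `0` for the empty heap and never negative. -/
def potential (h : FibForest α) : ℕ := 2 * (h.length + 2 * h.marks)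

/-- Insert a new one-node tree into the root list. -/
def insert (a : α) (h : FibForest α) : FibForest α := cons a false nil h

/-- Enter the tree with root `a`, mark `m` and children `c` into the array of trees indexed by
rank (written as the list of its occupied cells, in increasing order of rank). As long as the cell
of its rank is occupied, the two trees are linked: the root with the larger key becomes an unmarked
child of the other one. The second component counts one step for every link and one for
the final entry; addressing a cell of the array by its index takes no extra step. -/
def place [LinearOrder β] (key : α → β) (a : α) (m : Bool) (c : FibForest α) :
    FibForest α → FibForest α × ℕ
  | nil => (cons a m c nil, 1)
  | cons b mb cb r =>
      if c.length < cb.length then (cons a m c (cons b mb cb r), 1)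
      else if c.length = cb.length then
        if key a ≤ key b then
          ((place key a m (cons b false cb c) r).1, (place key a m (cons b false cb c) r).2 + 1)
        else
          ((place key b mb (cons a false c cb) r).1, (place key b mb (cons a false c cb) r).2 + 1)
      else (cons b mb cb (place key a m c r).1, (place key a m c r).2)

/-- Consolidation of a root list: all trees are entered into the array; with the step count. -/
def consolidate [LinearOrder β] (key : α → β) : FibForest α → FibForest α × ℕ
  | nil => (nil, 0)
  | cons a m c r =>
      ((place key a m c (consolidate key r).1).1,
        (consolidate key r).2 + (place key a m c (consolidate key r).1).2)

/-- Split off the root with minimal key: its element, its children, and the other trees.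
A Fibonacci heap keeps a pointer to this root, so this is not charged. -/
def splitMin [LinearOrder β] (key : α → β) :
    FibForest α → Option (α × FibForest α × FibForest α)
  | nil => none
  | cons a m c r =>
      match splitMin key r with
      | none => some (a, c, nil)
      | some (b, cb, rb) =>
          if key a ≤ key b then some (a, c, r) else some (b, cb, cons a m c rb)

/-- Extraction of a minimal element: the element, the new heap, and the number of steps. The
minimal root is removed (one step), each of its children is moved to the root list (one step each),
the root list is consolidated, and the cells of the array are gone through to collect the new
root list and find its minimum (one step for each cell). -/
def extractMin [LinearOrder β] (key : α → β) (h : FibForest α) :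
    Option (α × FibForest α × ℕ) :=
  match splitMin key h with
  | none => none
  | some (a, c, r) =>
      some (a, (consolidate key (c.append r)).1,
        1 + c.length + (consolidate key (c.append r)).2
          + ((consolidate key (c.append r)).1.maxRank + 1))

/-- Deletion of `x` from a list of siblings (below a root) and their descendants, with cascading
cuts: `none` if `x` does not occur, otherwise the new list of siblings, the trees
that are cut off and become roots, and whether the list of siblings has lost a member. A node that
loses a child is marked if it was not marked, and otherwise is cut off and unmarked. -/
def cut [DecidableEq α] (x : α) : FibForest α → Option (FibForest α × FibForest α × Bool)
  | nil => none
  | cons a m c r =>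
      if a = x then some (r, c, true)
      else
        match cut x c with
        | some (c', new, true) =>
            if m then some (r, cons a false c' new, true)
            else some (cons a true c' r, new, false)
        | some (c', new, false) => some (cons a m c' r, new, false)
        | none =>
            match cut x r with
            | some (r', new, lost) => some (cons a m c r', new, lost)
            | none => none

/-- Deletion of a node other than the minimal root; its children become roots. -/
def deleteAux [DecidableEq α] (x : α) : FibForest α → FibForest α
  | nil => nil
  | cons a m c r =>
      if a = x then c.append r
      else
        match cut x c with
        | some (c', new, _) => cons a m c' (new.append r)
        | none => cons a m c (deleteAux x r)

/-- Deletion of the element `x` from a Fibonacci heap. -/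
def delete [DecidableEq α] [LinearOrder β] (key : α → β) (x : α) (h : FibForest α) :
    FibForest α :=
  match extractMin key h with
  | none => nil
  | some (a, h', _) => if a = x then h' else deleteAux x h

end FibForest

/-! ## Multi-objective graphs and paths -/

/-- A multi-objective graph: a directed graph (an edge is an ordered pair of nodes) with
`W` non-negative objective values on each edge. -/
structure MOG (V : Type*) (W : ℕ) where
  Adj : V → V → Prop
  w : V → V → Fin W → ℝ
  w_nonneg : ∀ u v, Adj u v → ∀ j, 0 ≤ w u v j

namespace MOG

variable {V : Type*} {W K : ℕ}

/-- The paths from `s` to `v`: lists of nodes that start with `s` and end with `v`, any two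
consecutive ones being joined by an edge. Loops are allowed. -/
def paths (G : MOG V W) (s v : V) : Set (List V) :=
  {p | p.head? = some s ∧ p.getLast? = some v ∧ List.IsChain G.Adj p}

/-- The total value of the `j`-th objective along a list of nodes. -/
def objective (G : MOG V W) (p : List V) (j : Fin W) : ℝ :=
  ((p.zip p.tail).map fun e => G.w e.1 e.2 j).sum

/-- The cost of an edge with respect to a coefficient vector. -/
def edgeCost (G : MOG V W) (lam : Fin W → ℝ) (u v : V) : ℝ := ∑ j, lam j * G.w u v j

/-- The cost of a path with respect to a coefficient vector. -/
def cost (G : MOG V W) (lam : Fin W → ℝ) (p : List V) : ℝ :=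
  ((p.zip p.tail).map fun e => G.edgeCost lam e.1 e.2).sum

/-- `p` is an optimal path from `s` to `v` with respect to `lam`. -/
def IsOptimal (G : MOG V W) (s v : V) (lam : Fin W → ℝ) (p : List V) : Prop :=
  p ∈ G.paths s v ∧ ∀ q ∈ G.paths s v, G.cost lam p ≤ G.cost lam q

/-- `p` Pareto dominates `q`. -/
def Dominates (G : MOG V W) (p q : List V) : Prop :=
  (∀ j, G.objective p j ≤ G.objective q j) ∧ ∃ j, G.objective p j < G.objective q j

/-- The Pareto paths from `s` to `v`. -/
def paretoPaths (G : MOG V W) (s v : V) : Set (List V) :=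
  {p | p ∈ G.paths s v ∧ ∀ q ∈ G.paths s v, ¬ G.Dominates q p}

/-- The `l`-nodes: the nodes at the end of at most `l` different Pareto paths. -/
def lNodes (G : MOG V W) (s : V) (l : ℕ) : Set V :=
  {v | (G.paretoPaths s v).encard ≤ l}

/-- The ratio of `l`-nodes. -/
noncomputable def lRatio (G : MOG V W) (s : V) (l : ℕ) : ℝ :=
  ((G.lNodes s l).ncard : ℝ) / Nat.card V

/-- `L` is the least `l` for which the ratio of `l`-nodes is at least `1 - log |V| / |V|`. -/
def IsL (G : MOG V W) (s : V) (L : ℕ) : Prop :=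
  IsLeast {l : ℕ | 1 - Real.log (Nat.card V) / Nat.card V ≤ G.lRatio s l} L

/-! ## The algorithm IDAQ -/

/-- The priority of `p` with respect to `lam` is not null, where `queue` lists the paths in the
Adaptive Queue in the order in which they were pushed, and `popped` those popped so far. -/
def NonNull (G : MOG V W) (lam : Fin W → ℝ) (queue popped : List (List V)) (p : List V) : Prop :=
  ¬ ∃ b : List V, b ≠ p ∧ b.getLast? = p.getLast? ∧
    (((b ∈ queue ∨ b ∈ popped) ∧ G.cost lam b < G.cost lam p) ∨
      (List.Sublist [b, p] queue ∧ G.cost lam b = G.cost lam p) ∨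
      (b ∈ popped ∧ G.cost lam b = G.cost lam p))

open scoped Classical in
/-- The paths in the queue whose priority is not null. -/
noncomputable def active (G : MOG V W) (lam : Fin W → ℝ) (queue popped : List (List V)) :
    List (List V) :=
  queue.filter fun p => G.NonNull lam queue popped p

/-- The state of an execution of IDAQ. -/
structure State (V : Type*) (K : ℕ) where
  /-- the current iteration, counted from `0` -/
  iter : Fin K
  /-- the paths in the Adaptive Queue, in the order in which they were pushed -/
  queue : List (List V)
  /-- the Priority Heap of the Adaptive Queue -/
  heap : FibForest (List V)
  /-- the list `optimal_paths` -/
  optimalPaths : List (List V)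
  /-- all paths developed (popped from the queue) so far, with repetitions -/
  developed : List (List V)
  /-- the extensions of the last developed path that are still to be scanned -/
  toScan : List (List V)
  /-- the time spent developing paths so far -/
  developTime : ℤ

open scoped Classical in
/-- `Q_v`: the discovered paths, i.e. those in `queue` or `optimal_paths`, that end at `v`. -/
noncomputable def State.discovered (σ : State V K) (v : V) : Finset (List V) :=
  (σ.queue ++ σ.optimalPaths).toFinset.filter fun p => p.getLast? = some v

/-- `best` selects for each coefficient vector a path of `Q` of minimal cost. -/
def IsBest (G : MOG V W) (Λ : Fin K → Fin W → ℝ) (Q : Finset (List V))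
    (best : Fin K → List V) : Prop :=
  ∀ i, best i ∈ Q ∧ ∀ b ∈ Q, G.cost (Λ i) (best i) ≤ G.cost (Λ i) b

open scoped Classical in
/-- Is-Relevant returns `True` for the path `p`, where `Q` is the set of discovered paths with the
same end as `p`, and removes the paths of `R` from the discovered paths. -/
def Relevant (G : MOG V W) (Λ : Fin K → Fin W → ℝ) (Q : Finset (List V)) (p : List V)
    (R : Finset (List V)) : Prop :=
  if (Q.card : ℝ) < (K : ℝ) / W then
    (∀ b ∈ Q, ¬ G.Dominates b p) ∧ R = Q.filter fun b => G.Dominates p b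
  else
    ∃ best, G.IsBest Λ Q best ∧ (∃ i, G.cost (Λ i) p < G.cost (Λ i) (best i)) ∧
      R = Q.filter fun b =>
        ∀ i, b ≠ if G.cost (Λ i) p < G.cost (Λ i) (best i) then p else best i

open scoped Classical in
/-- Is-Relevant returns `False` for the path `p`. -/
def Irrelevant (G : MOG V W) (Λ : Fin K → Fin W → ℝ) (Q : Finset (List V)) (p : List V) : Prop :=
  if (Q.card : ℝ) < (K : ℝ) / W then ∃ b ∈ Q, G.Dominates b p
  else ∃ best, G.IsBest Λ Q best ∧ ∀ i, G.cost (Λ i) (best i) ≤ G.cost (Λ i) p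

open scoped Classical in
/-- Bring the Priority Heap up to date: paths that are no longer in the queue with a non-null
priority are deleted, and paths that newly have a non-null priority are inserted. -/
noncomputable def updateHeap (key : List V → ℝ) (old new : List (List V))
    (h : FibForest (List V)) : FibForest (List V) :=
  (new.filter fun p => p ∉ old).foldl (fun h p => h.insert p)
    ((old.filter fun p => p ∉ new).foldl (fun h p => h.delete key p) h)

open scoped Classical in
/-- The state after Is-Relevant has removed `R` from the discovered paths and `p` has been
pushed to the queue. -/
noncomputable def pushState (G : MOG V W) (Λ : Fin K → Fin W → ℝ) (σ : State V K) (p : List V)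
    (rest : List (List V)) (R : Finset (List V)) : State V K :=
  let lam := Λ σ.iter
  let queue := (σ.queue.filter fun b => b ∉ R) ++ [p]
  { σ with
    queue := queue
    heap := updateHeap (G.cost lam) (G.active lam σ.queue σ.developed)
      (G.active lam queue σ.developed) σ.heap
    optimalPaths := σ.optimalPaths.filter fun b => b ∉ R
    toScan := rest }

open scoped Classical in
/-- The state after `p` has been popped, in `steps` steps and leaving the Priority Heap `h`, and
inserted into `optimal_paths`. The time charged is that of the pop, amortized with respect to the
potential of the Fibonacci heap (number of steps plus increase of the potential), and one step for
the insertion. The paths in `ext` are to be scanned next. -/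
noncomputable def popState (σ : State V K) (p : List V) (h : FibForest (List V)) (steps : ℕ)
    (ext : List (List V)) : State V K :=
  { σ with
    queue := σ.queue.filter fun b => b ≠ p
    heap := h
    optimalPaths := σ.optimalPaths ++ [p]
    developed := σ.developed ++ [p]
    toScan := ext
    developTime := σ.developTime + ((steps : ℤ) + h.potential - σ.heap.potential) + 1 }

/-- The operation Adapt: the state at the beginning of iteration `i`. -/
noncomputable def adaptState (G : MOG V W) (Λ : Fin K → Fin W → ℝ) (σ : State V K) (i : Fin K) :
    State V K :=
  { σ with
    iter := i
    heap := (G.active (Λ i) σ.queue σ.developed).foldl (fun h p => h.insert p) .nil }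

/-- The initial state: the queue contains only the path `[s]`. -/
def initState (s : V) (hK : 0 < K) : State V K where
  iter := ⟨0, hK⟩
  queue := [[s]]
  heap := FibForest.insert [s] .nil
  optimalPaths := []
  developed := []
  toScan := []
  developTime := 0

/-- One step of IDAQ; `sample v` is the path to `v` in `pareto_sample`. IDAQ returns when
no step is possible, i.e. when nothing is left to scan and the Priority Heap is empty in the
last iteration. -/
inductive Step (G : MOG V W) (Λ : Fin K → Fin W → ℝ) (sample : V → List V) :
    State V K → State V K → Prop
  /-- The Priority Heap is empty, and the next iteration begins. -/
  | adapt (σ : State V K) (i : Fin K) (hscan : σ.toScan = []) (hempty : σ.heap = .nil)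
      (hi : (i : ℕ) = σ.iter + 1) : Step G Λ sample σ (adaptState G Λ σ i)
  /-- A path `p` is developed. The neighbors of its end `v` may be listed in any order. -/
  | develop (σ : State V K) (p : List V) (v : V) (h : FibForest (List V)) (steps : ℕ)
      (nbrs : List V) (hscan : σ.toScan = [])
      (hpop : σ.heap.extractMin (G.cost (Λ σ.iter)) = some (p, h, steps))
      (hv : p.getLast? = some v) (hnodup : nbrs.Nodup) (hnbrs : ∀ u, u ∈ nbrs ↔ G.Adj v u) :
      Step G Λ sample σ (popState σ p h steps (nbrs.map fun u => p ++ [u]))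
  /-- A scanned path is discarded, since the sample path dominates it. -/
  | scanDominated (σ : State V K) (q : List V) (v : V) (rest : List (List V))
      (hscan : σ.toScan = q :: rest) (hv : q.getLast? = some v)
      (hdom : G.Dominates (sample v) q) : Step G Λ sample σ { σ with toScan := rest }
  /-- A scanned path is discarded, since it is not relevant. -/
  | scanIrrelevant (σ : State V K) (q : List V) (v : V) (rest : List (List V))
      (hscan : σ.toScan = q :: rest) (hv : q.getLast? = some v)
      (hdom : ¬ G.Dominates (sample v) q)
      (hirr : G.Irrelevant Λ (σ.discovered v) q) : Step G Λ sample σ { σ with toScan := rest }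
  /-- A scanned path is relevant, and is pushed to the queue. -/
  | scanRelevant (σ : State V K) (q : List V) (v : V) (rest : List (List V))
      (R : Finset (List V)) (hscan : σ.toScan = q :: rest) (hv : q.getLast? = some v)
      (hdom : ¬ G.Dominates (sample v) q)
      (hrel : G.Relevant Λ (σ.discovered v) q R) :
      Step G Λ sample σ (pushState G Λ σ q rest R)

/-- `σ` is a state of some execution of IDAQ. -/
def Reachable (G : MOG V W) (Λ : Fin K → Fin W → ℝ) (sample : V → List V) (s : V) (hK : 0 < K)
    (σ : State V K) : Prop :=
  Relation.ReflTransGen (Step G Λ sample) (initState s hK) σ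

end MOG

/-! Developed paths are counted in two ways. Write `n` for the number of nodes.

Every popped path is optimal for the current coefficient vector (`Inv.isOptimal`). Otherwise take a
cheaper optimal path `o` to the same end and follow it edge by edge: each node on it turns out to be
the end of a developed path that costs no more than the corresponding initial segment of `o`. At the
last node this contradicts the non-null priority of the popped path. The induction rests on the
`covered` clause of `Inv`: every path whose parent was developed is still to be scanned, or is
dominated by a sample path, or is matched for each coefficient vector by a discovered path that
costs no more. Discarding and removing paths preserves this, because whatever is lost is matched for
every vector by something kept.

Once an optimal path to a node has been developed, every other queued path to that node has null
priority, so a node receives at most one developed path per iteration, hence at most `K`. Positive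
coefficients make optimal paths Pareto, and no path is developed twice, so an `L`-node receives at
most `L`. At most `log n` nodes are not `L`-nodes, which gives `L * n + K * log n` developed paths
(`Inv.length_developed_le`). Since `K = O(√n)`, `log n ≤ 2√n` and `L ≥ 1`, the second term is `O(L *
n)`.

For the time, the heap holds at most one path per end node (`length_active_le`), and extraction from
a Fibonacci heap with at most `n` elements has amortized cost `O(log n)`
(`FibForest.extractMin_amortized_le`). That bound holds for each extraction from a well-formed heap,
so insertions and deletions only have to preserve well-formedness; their effect on the potential
does not matter. -/

namespace FibForest

/-! ### Well-formedness of Fibonacci heaps -/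

variable {α β : Type*}

/-- The multiset of the elements of a forest. -/
def elems : FibForest α → Multiset α
  | nil => 0
  | cons a _ c r => a ::ₘ (c.elems + r.elems)

/-- Every element is at most as large as those in the subtree below it. -/
def Ordered [LinearOrder β] (key : α → β) : FibForest α → Prop
  | nil => True
  | cons a _ c r => (∀ x ∈ c.elems, key a ≤ key x) ∧ c.Ordered key ∧ r.Ordered key

/-- The rank condition on a list of siblings below a root: a node has at least as many children
as older siblings, up to the one child that a marked node has lost. -/
def ChildrenWF : FibForest α → Prop
  | nil => True
  | cons _ m c r => r.length ≤ c.length + (if m then 1 else 0) ∧ c.ChildrenWF ∧ r.ChildrenWF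

/-- The rank condition on a list of roots. -/
def RootsWF : FibForest α → Prop
  | nil => True
  | cons _ _ c r => c.ChildrenWF ∧ r.RootsWF

/-- The ranks of the roots are at least `lo` and strictly increasing. -/
def RanksIncreasing : ℕ → FibForest α → Prop
  | _, nil => True
  | lo, cons _ _ c r => lo ≤ c.length ∧ RanksIncreasing (c.length + 1) r

theorem ChildrenWF.rootsWF {h : FibForest α} (hh : h.ChildrenWF) : h.RootsWF := by
  induction h with
  | nil => trivial
  | cons a m c r _ ihr => exact ⟨hh.2.1, ihr hh.2.2⟩

/-! ### Concatenation -/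

@[simp] theorem elems_append (g h : FibForest α) : (g.append h).elems = g.elems + h.elems := by
  induction g with
  | nil => simp [append, elems]
  | cons a m c r _ ihr => simp [append, elems, ihr, add_assoc]

@[simp] theorem length_append (g h : FibForest α) :
    (g.append h).length = g.length + h.length := by
  induction g with
  | nil => simp [append, length]
  | cons a m c r _ ihr => simp [append, length, ihr]; omega

@[simp] theorem marks_append (g h : FibForest α) : (g.append h).marks = g.marks + h.marks := by
  induction g with
  | nil => simp [append, marks]
  | cons a m c r _ ihr => simp [append, marks, ihr]; omega

theorem Ordered.append [LinearOrder β] {key : α → β} {g h : FibForest α} (hg : g.Ordered key)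
    (hh : h.Ordered key) : (g.append h).Ordered key := by
  induction g with
  | nil => exact hh
  | cons a m c r _ ihr => exact ⟨hg.1, hg.2.1, ihr hg.2.2⟩

theorem RootsWF.append {g h : FibForest α} (hg : g.RootsWF) (hh : h.RootsWF) :
    (g.append h).RootsWF := by
  induction g with
  | nil => exact hh
  | cons a m c r _ ihr => exact ⟨hg.1, ihr hg.2⟩

/-! ### Consolidation -/

section Consolidate

variable [LinearOrder β] (key : α → β)

theorem elems_place (h : FibForest α) (a : α) (m : Bool) (c : FibForest α) :
    (place key a m c h).1.elems = a ::ₘ (c.elems + h.elems) := by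
  induction h generalizing a m c with
  | nil => simp [place, elems]
  | cons b mb cb r _ ihr =>
    unfold place
    split_ifs <;> simp only [elems, ihr, ← Multiset.singleton_add] <;> abel

/-- Each link costs one step and removes one tree, so trees plus steps is conserved; the 2 is the
entering tree and the step of its final entry. This is why the potential weighs a tree by 2. -/
theorem length_place_add (h : FibForest α) (a : α) (m : Bool) (c : FibForest α) :
    (place key a m c h).1.length + (place key a m c h).2 = h.length + 2 := by
  induction h generalizing a m c with
  | nil => simp [place, length]
  | cons b mb cb r _ ihr =>
    unfold place
    split_ifs
    · simp [length]
    · have := ihr a m (cons b false cb c)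
      simp only [length] at *; omega
    · have := ihr b mb (cons a false c cb)
      simp only [length] at *; omega
    · have := ihr a m c
      simp only [length] at *; omega

theorem marks_place_le (h : FibForest α) (a : α) (m : Bool) (c : FibForest α) :
    (place key a m c h).1.marks ≤ (if m then 1 else 0) + c.marks + h.marks := by
  induction h generalizing a m c with
  | nil => simp [place, marks]
  | cons b mb cb r _ ihr =>
    unfold place
    by_cases h1 : c.length < cb.length
    · rw [if_pos h1]; simp only [marks]; omega
    rw [if_neg h1]
    by_cases h2 : c.length = cb.length
    · rw [if_pos h2]
      by_cases h3 : key a ≤ key b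
      · have := ihr a m (cons b false cb c)
        rw [if_pos h3]
        simp only [marks, Bool.false_eq_true, if_false] at *; omega
      · have := ihr b mb (cons a false c cb)
        rw [if_neg h3]
        simp only [marks, Bool.false_eq_true, if_false] at *; omega
    · have := ihr a m c
      rw [if_neg h2]
      simp only [marks] at *; omega

theorem Ordered.place {key : α → β} {h : FibForest α} (hh : h.Ordered key) (a : α) (m : Bool)
    {c : FibForest α} (hc : c.Ordered key) (hac : ∀ x ∈ c.elems, key a ≤ key x) :
    (place key a m c h).1.Ordered key := by
  induction h generalizing a m c with
  | nil => exact ⟨hac, hc, trivial⟩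
  | cons b mb cb r _ ihr =>
    obtain ⟨hb, hcb, hr⟩ := hh
    unfold FibForest.place
    split_ifs with h1 h2 h3
    · exact ⟨hac, hc, hb, hcb, hr⟩
    · refine ihr hr a m ⟨hb, hcb, hc⟩ fun x hx => ?_
      simp only [elems, Multiset.mem_cons, Multiset.mem_add] at hx
      rcases hx with rfl | hx | hx
      exacts [h3, h3.trans (hb x hx), hac x hx]
    · refine ihr hr b mb ⟨hac, hc, hcb⟩ fun x hx => ?_
      have h3 := (not_le.1 h3).le
      simp only [elems, Multiset.mem_cons, Multiset.mem_add] at hx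
      rcases hx with rfl | hx | hx
      exacts [h3, h3.trans (hac x hx), hb x hx]
    · exact ⟨hb, hcb, ihr hr a m hc hac⟩

/-- Only roots of equal rank are linked, so a new child has exactly as many children as it has older
siblings. -/
theorem RootsWF.place {h : FibForest α} (hh : h.RootsWF) (a : α) (m : Bool)
    {c : FibForest α} (hc : c.ChildrenWF) : (place key a m c h).1.RootsWF := by
  induction h generalizing a m c with
  | nil => exact ⟨hc, trivial⟩
  | cons b mb cb r _ ihr =>
    obtain ⟨hcb, hr⟩ := hh
    unfold FibForest.place
    split_ifs with h1 h2 h3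
    · exact ⟨hc, hcb, hr⟩
    · exact ihr hr a m ⟨by omega, hcb, hc⟩
    · exact ihr hr b mb ⟨by omega, hc, hcb⟩
    · exact ⟨hcb, ihr hr a m hc⟩

theorem RanksIncreasing.mono {lo lo' : ℕ} {h : FibForest α} (hh : RanksIncreasing lo h)
    (hl : lo' ≤ lo) : RanksIncreasing lo' h := by
  cases h with
  | nil => trivial
  | cons a m c r => exact ⟨hl.trans hh.1, hh.2⟩

/-- A link produces a tree of rank one higher, which is precisely the lower bound on the remaining
cells, so the carry propagates as in binary addition. -/
theorem RanksIncreasing.place {lo : ℕ} {h : FibForest α} (hh : RanksIncreasing lo h) (a : α)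
    (m : Bool) {c : FibForest α} (hc : lo ≤ c.length) :
    RanksIncreasing lo (place key a m c h).1 := by
  induction h generalizing lo a m c with
  | nil => exact ⟨hc, trivial⟩
  | cons b mb cb r _ ihr =>
    obtain ⟨hcb, hr⟩ := hh
    unfold FibForest.place
    split_ifs with h1 h2 h3
    · exact ⟨hc, h1, hr⟩
    · exact (ihr hr a m (by simp only [length]; omega)).mono (by omega)
    · exact (ihr hr b mb (by simp only [length]; omega)).mono (by omega)
    · exact ⟨hcb, ihr hr a m (by omega)⟩

theorem RanksIncreasing.length_add_le {lo : ℕ} {h : FibForest α} (hh : RanksIncreasing lo h) :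
    h = nil ∨ h.length + lo ≤ h.maxRank + 1 := by
  induction h generalizing lo with
  | nil => exact Or.inl rfl
  | cons a m c r _ ihr =>
    right
    obtain ⟨h1, h2⟩ := hh
    rcases ihr h2 with rfl | h3
    · simp [length, maxRank]; omega
    · simp only [length, maxRank]; omega

theorem RanksIncreasing.length_le {lo : ℕ} {h : FibForest α} (hh : RanksIncreasing lo h) :
    h.length ≤ h.maxRank + 1 := by
  rcases hh.length_add_le with rfl | h
  · simp [length]
  · omega

theorem elems_consolidate (h : FibForest α) : (consolidate key h).1.elems = h.elems := by
  induction h with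
  | nil => rfl
  | cons a m c r _ ihr => simp [consolidate, elems_place, elems, ihr]

theorem length_consolidate_add (h : FibForest α) :
    (consolidate key h).1.length + (consolidate key h).2 = 2 * h.length := by
  induction h with
  | nil => rfl
  | cons a m c r _ ihr =>
    have := length_place_add key (consolidate key r).1 a m c
    simp only [consolidate, length]; omega

theorem marks_consolidate_le (h : FibForest α) : (consolidate key h).1.marks ≤ h.marks := by
  induction h with
  | nil => rfl
  | cons a m c r _ ihr =>
    have := marks_place_le key (consolidate key r).1 a m c
    simp only [consolidate, marks]; omega

theorem Ordered.consolidate {key : α → β} {h : FibForest α} (hh : h.Ordered key) :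
    (consolidate key h).1.Ordered key := by
  induction h with
  | nil => trivial
  | cons a m c r _ ihr => exact (ihr hh.2.2).place a m hh.2.1 hh.1

theorem RootsWF.consolidate {h : FibForest α} (hh : h.RootsWF) :
    (consolidate key h).1.RootsWF := by
  induction h with
  | nil => trivial
  | cons a m c r _ ihr => exact (ihr hh.2).place key a m hh.1

theorem ranksIncreasing_consolidate (h : FibForest α) :
    RanksIncreasing 0 (consolidate key h).1 := by
  induction h with
  | nil => trivial
  | cons a m c r _ ihr => exact ihr.place key a m (Nat.zero_le _)

/-! ### Extraction of the minimum -/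

variable {key}

theorem splitMin_eq_none {h : FibForest α} (hh : splitMin key h = none) : h = nil := by
  cases h with
  | nil => rfl
  | cons a m c r =>
    unfold splitMin at hh
    split at hh
    · cases hh
    · split_ifs at hh

theorem splitMin_spec {h : FibForest α} {a : α} {c r : FibForest α}
    (hh : splitMin key h = some (a, c, r)) :
    h.elems = a ::ₘ (c.elems + r.elems) ∧ r.length + 1 = h.length ∧
      c.marks + r.marks ≤ h.marks ∧ (h.RootsWF → c.ChildrenWF ∧ r.RootsWF) ∧
      (h.Ordered key → c.Ordered key ∧ r.Ordered key ∧ ∀ x ∈ h.elems, key a ≤ key x) := by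
  induction h generalizing a c r with
  | nil => cases hh
  | cons b m cb rb _ ihr =>
    unfold splitMin at hh
    split at hh
    next h0 =>
      obtain rfl := splitMin_eq_none h0
      simp only [Option.some.injEq, Prod.mk.injEq] at hh
      obtain ⟨rfl, rfl, rfl⟩ := hh
      refine ⟨rfl, rfl, by simp [marks], fun h => h, fun h => ⟨h.2.1, h.2.2, ?_⟩⟩
      intro x hx
      simp only [elems, add_zero, Multiset.mem_cons] at hx
      rcases hx with rfl | hx
      exacts [le_rfl, h.1 x hx]
    next a' c' r' h0 =>
      obtain ⟨e, l, mk, wf, od⟩ := ihr h0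
      split_ifs at hh with hk
      all_goals
        simp only [Option.some.injEq, Prod.mk.injEq] at hh
        obtain ⟨rfl, rfl, rfl⟩ := hh
      · refine ⟨rfl, rfl, by simp [marks], fun h => h, fun h => ⟨h.2.1, h.2.2, ?_⟩⟩
        intro x hx
        simp only [elems, Multiset.mem_cons, Multiset.mem_add] at hx
        rcases hx with rfl | hx | hx
        exacts [le_rfl, h.1 x hx, hk.trans ((od h.2.2).2.2 x hx)]
      · have hk := (not_le.1 hk).le
        refine ⟨?_, by simp only [length]; omega, by simp only [marks]; omega,
          fun h => ⟨(wf h.2).1, h.1, (wf h.2).2⟩,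
          fun h => ⟨(od h.2.2).1, ⟨h.1, h.2.1, (od h.2.2).2.1⟩, ?_⟩⟩
        · simp only [elems, e, ← Multiset.singleton_add]; abel
        · intro x hx
          simp only [elems, Multiset.mem_cons, Multiset.mem_add] at hx
          rcases hx with rfl | hx | hx
          exacts [hk, hk.trans (h.1 x hx), (od h.2.2).2.2 x hx]

theorem extractMin_eq_none {h : FibForest α} (hh : extractMin key h = none) : h = nil := by
  unfold extractMin at hh
  split at hh
  next h0 => exact splitMin_eq_none h0
  next => cases hh

/-- The youngest sibling has rank at least the number of older siblings minus one, the one being the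
child a marked node may have lost. Its subtree and the older siblings supply the two terms of the
Fibonacci recursion. -/
theorem fib_length_le {h : FibForest α} (hh : h.ChildrenWF) :
    Nat.fib (h.length + 2) ≤ h.elems.card + 1 := by
  induction h with
  | nil => simp [length, elems]
  | cons a m c r ihc ihr =>
    obtain ⟨h1, h2, h3⟩ := hh
    have hc := ihc h2
    have hr := ihr h3
    have h4 : Nat.fib (r.length + 1) ≤ Nat.fib (c.length + 2) :=
      Nat.fib_mono (by split_ifs at h1 <;> omega)
    have h5 : Nat.fib (r.length + 1 + 2) = Nat.fib (r.length + 1) + Nat.fib (r.length + 2) :=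
      Nat.fib_add_two
    simp only [length, elems, Multiset.card_cons, Multiset.card_add]
    omega

theorem fib_maxRank_le {h : FibForest α} (hh : h.RootsWF) :
    Nat.fib (h.maxRank + 2) ≤ max 1 h.elems.card := by
  induction h with
  | nil => simp [maxRank]
  | cons a m c r _ ihr =>
    have hc := fib_length_le hh.1
    have hr := ihr hh.2
    simp only [maxRank, elems, Multiset.card_cons, Multiset.card_add]
    rcases max_cases c.length r.maxRank with ⟨h, -⟩ | ⟨h, -⟩ <;> rw [h] <;> omega

theorem pow_le_fib (k : ℕ) : ((3 : ℝ) / 2) ^ k ≤ Nat.fib (k + 2) := by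
  induction k using Nat.twoStepInduction with
  | zero => simp
  | one => norm_num [Nat.fib]
  | more k h1 h2 =>
    have h : Nat.fib (k + 1 + 1 + 2) = Nat.fib (k + 2) + Nat.fib (k + 1 + 2) := Nat.fib_add_two
    rw [h]
    push_cast
    have : (0 : ℝ) ≤ (3 / 2) ^ k := by positivity
    calc ((3 : ℝ) / 2) ^ (k + 1 + 1) ≤ (3 / 2) ^ k + (3 / 2) ^ (k + 1) := by ring_nf; linarith
      _ ≤ _ := add_le_add h1 h2

theorem le_log_of_fib_le {k n : ℕ} (h : Nat.fib (k + 2) ≤ n) : (k : ℝ) ≤ 3 * Real.log n := by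
  have h1 : ((3 : ℝ) / 2) ^ k ≤ n := (pow_le_fib k).trans (by exact_mod_cast h)
  have h2 := Real.log_le_log (by positivity) h1
  rw [Real.log_pow] at h2
  -- From `log x ≥ 1 - 1/x`; this is the source of the factor 3.
  have h3 : (1 : ℝ) / 3 ≤ Real.log (3 / 2) := by
    have := Real.one_sub_inv_le_log_of_pos (show (0 : ℝ) < 3 / 2 by norm_num)
    norm_num at this ⊢; linarith
  nlinarith [(Nat.cast_nonneg k : (0 : ℝ) ≤ k)]

theorem extractMin_spec {h h' : FibForest α} {a : α} {steps : ℕ}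
    (hh : extractMin key h = some (a, h', steps)) :
    h.elems = a ::ₘ h'.elems ∧ (h.RootsWF → h'.RootsWF) ∧
      (h.Ordered key → h'.Ordered key ∧ ∀ x ∈ h.elems, key a ≤ key x) := by
  unfold extractMin at hh
  split at hh
  next => cases hh
  next a' c r h0 =>
    simp only [Option.some.injEq, Prod.mk.injEq] at hh
    obtain ⟨rfl, rfl, -⟩ := hh
    obtain ⟨e, -, -, wf, od⟩ := splitMin_spec h0
    refine ⟨by rw [e, elems_consolidate, elems_append], fun h => ?_, fun h => ⟨?_, (od h).2.2⟩⟩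
    · exact ((wf h).1.rootsWF.append (wf h).2).consolidate key
    · exact ((od h).1.append (od h).2.1).consolidate

/-- The amortized cost of the extraction of the minimum is logarithmic. -/
theorem extractMin_amortized_le {h h' : FibForest α} {a : α} {steps n : ℕ}
    (hh : extractMin key h = some (a, h', steps)) (hwf : h.RootsWF) (hn : h.elems.card ≤ n) :
    (steps : ℝ) + h'.potential - h.potential ≤ 15 * Real.log n + 1 := by
  have hpos : 0 < h.elems.card := by rw [(extractMin_spec hh).1]; simp
  have hr' := fib_maxRank_le ((extractMin_spec hh).2.1 hwf)
  have hsz : h'.elems.card + 1 = h.elems.card := by rw [(extractMin_spec hh).1]; simp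
  have hlog' := le_log_of_fib_le (n := n) (k := h'.maxRank) (by omega)
  unfold extractMin at hh
  split at hh
  next => cases hh
  next a' c r h0 =>
    simp only [Option.some.injEq, Prod.mk.injEq] at hh
    obtain ⟨rfl, rfl, rfl⟩ := hh
    obtain ⟨e, l, mk, wf, -⟩ := splitMin_spec h0
    have hc := fib_length_le (wf hwf).1
    have hcs : c.elems.card + 1 ≤ n := by
      rw [e, Multiset.card_cons, Multiset.card_add] at hn; omega
    have hlog := le_log_of_fib_le (n := n) (k := c.length) (by omega)
    have h1 := length_consolidate_add key (c.append r)
    have h2 := marks_consolidate_le key (c.append r)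
    have h3 := (ranksIncreasing_consolidate key (c.append r)).length_le
    rw [length_append] at h1
    rw [marks_append] at h2
    -- With `d` the rank of the removed root and `t` the new number of trees, consolidation takes `2
    -- * (d + h.length - 1) - t` steps. The old potential pays for `2 * h.length`, and `t` is at
    -- most the new maximal rank plus one. Both ranks are at most `3 * log n`, whence `9 + 6 = 15`.
    have key : 1 + c.length + (FibForest.consolidate key (c.append r)).2 +
          ((FibForest.consolidate key (c.append r)).1.maxRank + 1) +
          (FibForest.consolidate key (c.append r)).1.potential ≤
        h.potential + 3 * c.length + 2 * (FibForest.consolidate key (c.append r)).1.maxRank + 1 := by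
      simp only [potential]; omega
    have key' := (Nat.cast_le (α := ℝ)).2 key
    push_cast at key' ⊢
    linarith

end Consolidate

/-! ### Deletion and insertion -/

section Delete

section

variable [DecidableEq α]

theorem cut_eq_none {x : α} {f : FibForest α} (h : cut x f = none) : x ∉ f.elems := by
  induction f with
  | nil => simp [elems]
  | cons a m c r ihc ihr =>
    unfold cut at h
    by_cases hax : a = x
    · rw [if_pos hax] at h; cases h
    rw [if_neg hax] at h
    split at h
    · split_ifs at h
    · cases h
    next h1 =>
      split at h
      · cases h
      next h2 =>
        simp only [elems, Multiset.mem_cons, Multiset.mem_add, not_or]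
        exact ⟨fun h => hax h.symm, ihc h1, ihr h2⟩

/-- The rank condition survives because an unmarked node that loses a child gains a mark, which
allows for the loss, while a marked one is cut off and becomes a root, where nothing is required.
Losing a sibling only weakens the condition on the younger ones. -/
theorem cut_spec {x : α} {f f' new : FibForest α} {lost : Bool}
    (h : cut x f = some (f', new, lost)) :
    f.elems = x ::ₘ (f'.elems + new.elems) ∧
      (f'.length + (if lost then 1 else 0) = f.length) ∧
      (f.ChildrenWF → f'.ChildrenWF ∧ new.RootsWF) := by
  induction f generalizing f' new lost with
  | nil => cases h
  | cons a m c r ihc ihr =>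
    unfold cut at h
    by_cases hax : a = x
    · rw [if_pos hax] at h
      simp only [Option.some.injEq, Prod.mk.injEq] at h
      obtain ⟨rfl, rfl, rfl⟩ := h
      subst hax
      exact ⟨by simp only [elems, add_comm], rfl, fun h => ⟨h.2.2, h.2.1.rootsWF⟩⟩
    · rw [if_neg hax] at h
      split at h
      next c' nw h0 =>
        obtain ⟨e, l, wf⟩ := ihc h0
        simp only [if_true] at l
        split_ifs at h with hm
        all_goals
          simp only [Option.some.injEq, Prod.mk.injEq] at h
          obtain ⟨rfl, rfl, rfl⟩ := h
        · refine ⟨?_, rfl, fun h => ⟨h.2.2, (wf h.2.1).1, (wf h.2.1).2⟩⟩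
          simp only [elems, e, ← Multiset.singleton_add]; abel
        · refine ⟨?_, by simp [length], fun h => ⟨⟨?_, (wf h.2.1).1, h.2.2⟩, (wf h.2.1).2⟩⟩
          · simp only [elems, e, ← Multiset.singleton_add]; abel
          · have := h.1
            simp only [hm, if_true] at this ⊢
            simp at this
            omega
      next c' nw h0 =>
        obtain ⟨e, l, wf⟩ := ihc h0
        simp only [Option.some.injEq, Prod.mk.injEq] at h
        obtain ⟨rfl, rfl, rfl⟩ := h
        simp at l
        refine ⟨?_, by simp [length], fun h => ⟨⟨by rw [l]; exact h.1, (wf h.2.1).1, h.2.2⟩,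
          (wf h.2.1).2⟩⟩
        simp only [elems, e, ← Multiset.singleton_add]; abel
      next =>
        split at h
        next r' nw ls h0 =>
          obtain ⟨e, l, wf⟩ := ihr h0
          simp only [Option.some.injEq, Prod.mk.injEq] at h
          obtain ⟨rfl, rfl, rfl⟩ := h
          refine ⟨?_, by simp only [length]; omega,
            fun h => ⟨⟨le_trans (by omega) h.1, h.2.1, (wf h.2.2).1⟩, (wf h.2.2).2⟩⟩
          simp only [elems, e, ← Multiset.singleton_add]; abel
        next => cases h

theorem cut_ordered [LinearOrder β] {key : α → β} {x : α} {f f' new : FibForest α} {lost : Bool}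
    (h : cut x f = some (f', new, lost)) (hf : f.Ordered key) :
    f'.Ordered key ∧ new.Ordered key := by
  induction f generalizing f' new lost with
  | nil => cases h
  | cons a m c r ihc ihr =>
    obtain ⟨ha, hc, hr⟩ := hf
    have hsub {c' nw : FibForest α} {ls : Bool} (h0 : cut x c = some (c', nw, ls)) :
        ∀ y ∈ c'.elems, key a ≤ key y := fun y hy =>
      ha y (by rw [(cut_spec h0).1]; simp [hy])
    unfold cut at h
    by_cases hax : a = x
    · rw [if_pos hax] at h
      simp only [Option.some.injEq, Prod.mk.injEq] at h
      obtain ⟨rfl, rfl, rfl⟩ := h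
      exact ⟨hr, hc⟩
    · rw [if_neg hax] at h
      split at h
      next c' nw h0 =>
        have h1 := ihc h0 hc
        have h2 := hsub h0
        split_ifs at h with hm
        all_goals
          simp only [Option.some.injEq, Prod.mk.injEq] at h
          obtain ⟨rfl, rfl, rfl⟩ := h
        exacts [⟨hr, h2, h1⟩, ⟨⟨h2, h1.1, hr⟩, h1.2⟩]
      next c' nw h0 =>
        have h1 := ihc h0 hc
        have h2 := hsub h0
        simp only [Option.some.injEq, Prod.mk.injEq] at h
        obtain ⟨rfl, rfl, rfl⟩ := h
        exact ⟨⟨h2, h1.1, hr⟩, h1.2⟩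
      next =>
        split at h
        next r' nw ls h0 =>
          simp only [Option.some.injEq, Prod.mk.injEq] at h
          obtain ⟨rfl, rfl, rfl⟩ := h
          exact ⟨⟨ha, hc, (ihr h0 hr).1⟩, (ihr h0 hr).2⟩
        next => cases h

theorem elems_deleteAux (x : α) (h : FibForest α) :
    (deleteAux x h).elems = h.elems.erase x := by
  induction h with
  | nil => simp [deleteAux, elems]
  | cons a m c r _ ihr =>
    unfold deleteAux
    split_ifs with hax
    · subst hax; simp [elems]
    · split
      next c' nw ls h0 =>
        simp only [elems, (cut_spec h0).1, elems_append]
        rw [Multiset.erase_cons_tail _ hax, Multiset.cons_add, Multiset.erase_cons_head, add_assoc]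
      next h0 =>
        simp only [elems, ihr]
        rw [Multiset.erase_cons_tail _ hax, Multiset.erase_add_right_neg _ (cut_eq_none h0)]

theorem RootsWF.deleteAux {h : FibForest α} (hh : h.RootsWF) (x : α) :
    (deleteAux x h).RootsWF := by
  induction h with
  | nil => trivial
  | cons a m c r _ ihr =>
    unfold FibForest.deleteAux
    split_ifs with hax
    · exact hh.1.rootsWF.append hh.2
    · split
      next c' nw ls h0 =>
        have := (cut_spec h0).2.2 hh.1
        exact ⟨this.1, this.2.append hh.2⟩
      next => exact ⟨hh.1, ihr hh.2⟩

theorem Ordered.deleteAux [LinearOrder β] {key : α → β} {h : FibForest α} (hh : h.Ordered key)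
    (x : α) : (deleteAux x h).Ordered key := by
  induction h with
  | nil => trivial
  | cons a m c r _ ihr =>
    obtain ⟨ha, hc, hr⟩ := hh
    unfold FibForest.deleteAux
    split_ifs with hax
    · exact hc.append hr
    · split
      next c' nw ls h0 =>
        have := cut_ordered h0 hc
        exact ⟨fun y hy => ha y (by rw [(cut_spec h0).1]; simp [hy]), this.1, this.2.append hr⟩
      next => exact ⟨ha, hc, ihr hr⟩

end

/-- A well-formed Fibonacci heap with the elements `s`. -/
structure IsHeap [LinearOrder β] (key : α → β) (h : FibForest α) (s : Multiset α) : Prop where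
  elems_eq : h.elems = s
  ordered : h.Ordered key
  rootsWF : h.RootsWF

variable [LinearOrder β] {key : α → β} {h : FibForest α} {s : Multiset α}

theorem isHeap_nil : IsHeap key (nil : FibForest α) 0 := ⟨rfl, trivial, trivial⟩

theorem IsHeap.insert (hh : IsHeap key h s) (a : α) : IsHeap key (h.insert a) (a ::ₘ s) :=
  ⟨by simp [FibForest.insert, elems, hh.elems_eq],
    ⟨fun _ h => absurd h (Multiset.notMem_zero _), trivial, hh.ordered⟩, trivial, hh.rootsWF⟩

theorem IsHeap.delete [DecidableEq α] (hh : IsHeap key h s) (x : α) :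
    IsHeap key (h.delete key x) (s.erase x) := by
  obtain ⟨rfl, ho, hw⟩ := hh
  unfold FibForest.delete
  split
  next h0 =>
    obtain rfl := extractMin_eq_none h0
    exact ⟨by simp [elems], trivial, trivial⟩
  next a h' n h0 =>
    obtain ⟨e, wf, od⟩ := extractMin_spec h0
    split_ifs with hax
    · subst hax
      exact ⟨by simp [e], (od ho).1, wf hw⟩
    · exact ⟨elems_deleteAux x h, ho.deleteAux x, hw.deleteAux x⟩

theorem IsHeap.foldl_insert (hh : IsHeap key h s) (l : List α) :
    IsHeap key (l.foldl (fun h p => h.insert p) h) (l + s) := by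
  induction l generalizing h s with
  | nil => simpa using hh
  | cons a l ih => simpa [← Multiset.cons_coe] using ih (hh.insert a)

theorem IsHeap.foldl_delete [DecidableEq α] (hh : IsHeap key h s) (l : List α) :
    IsHeap key (l.foldl (fun h p => h.delete key p) h) (s - l) := by
  induction l generalizing h s with
  | nil => simpa using hh
  | cons a l ih => simpa [← Multiset.cons_coe, Multiset.sub_cons] using ih (hh.delete a)

end Delete

end FibForest

namespace MOG

variable {V : Type*} {W K : ℕ} {G : MOG V W} {s u v : V} {lam : Fin W → ℝ} {p q : List V}

/-! ### Paths, costs and domination -/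

theorem sum_edges_snoc (f : V × V → ℝ) (hp : p.getLast? = some v) (u : V) :
    (((p ++ [u]).zip (p ++ [u]).tail).map f).sum = ((p.zip p.tail).map f).sum + f (v, u) := by
  induction p with
  | nil => simp at hp
  | cons a l ih =>
    cases l with
    | nil =>
      simp only [List.getLast?_singleton, Option.some.injEq] at hp
      simp [hp]
    | cons b l =>
      rw [List.getLast?_cons_cons] at hp
      have := ih hp
      simp only [List.cons_append, List.tail_cons, List.zip_cons_cons, List.map_cons,
        List.sum_cons] at this ⊢
      rw [this, add_assoc]

theorem cost_snoc (hp : p.getLast? = some v) (u : V) :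
    G.cost lam (p ++ [u]) = G.cost lam p + G.edgeCost lam v u :=
  sum_edges_snoc (fun e => G.edgeCost lam e.1 e.2) hp u

theorem cost_eq_sum_objective (G : MOG V W) (lam : Fin W → ℝ) (p : List V) :
    G.cost lam p = ∑ j, lam j * G.objective p j := by
  unfold cost objective
  induction p.zip p.tail with
  | nil => simp
  | cons e l ih =>
    simp only [List.map_cons, List.sum_cons, ih, mul_add, Finset.sum_add_distrib]
    rfl

theorem edgeCost_nonneg (hlam : ∀ j, 0 < lam j) (h : G.Adj u v) : 0 ≤ G.edgeCost lam u v :=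
  Finset.sum_nonneg fun j _ => mul_nonneg (hlam j).le (G.w_nonneg u v h j)

theorem Dominates.cost_lt (hlam : ∀ j, 0 < lam j) (h : G.Dominates p q) :
    G.cost lam p < G.cost lam q := by
  rw [cost_eq_sum_objective, cost_eq_sum_objective]
  obtain ⟨h1, j, hj⟩ := h
  exact Finset.sum_lt_sum (fun i _ => mul_le_mul_of_nonneg_left (h1 i) (hlam i).le)
    ⟨j, Finset.mem_univ j, mul_lt_mul_of_pos_left hj (hlam j)⟩

theorem singleton_mem_paths : [s] ∈ G.paths s s := ⟨rfl, rfl, by simp⟩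

theorem snoc_mem_paths (hp : p ∈ G.paths s v) (h : G.Adj v u) : p ++ [u] ∈ G.paths s u := by
  obtain ⟨h1, h2, h3⟩ := hp
  refine ⟨by cases p <;> simp_all, by simp, ?_⟩
  rw [List.isChain_append]
  refine ⟨h3, by simp, ?_⟩
  intro x hx y hy
  simp_all

theorem eq_or_eq_snoc (hp : p ∈ G.paths s v) :
    (p = [s] ∧ v = s) ∨ ∃ (q : List V) (u : V), q ∈ G.paths s u ∧ G.Adj u v ∧ p = q ++ [v] := by
  obtain ⟨h1, h2, h3⟩ := hp
  rcases List.eq_nil_or_concat p with rfl | ⟨q, x, rfl⟩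
  · simp at h1
  simp only [List.concat_eq_append, List.getLast?_concat, Option.some.injEq] at h1 h2 h3 ⊢
  subst h2
  rcases List.eq_nil_or_concat q with rfl | ⟨r, y, rfl⟩
  · left; simpa using h1
  · right
    simp only [List.concat_eq_append] at *
    rw [List.isChain_append] at h3
    refine ⟨r ++ [y], y, ⟨?_, by simp, h3.1⟩, h3.2.2 y (by simp) x (by simp), rfl⟩
    cases r <;> simp_all

theorem mem_paths_induction {P : List V → V → Prop} (h0 : P [s] s)
    (h1 : ∀ p v u, p ∈ G.paths s v → G.Adj v u → P p v → P (p ++ [u]) u)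
    (hp : p ∈ G.paths s v) : P p v := by
  induction hn : p.length generalizing p v with
  | zero => simp_all [paths, List.length_eq_zero_iff]
  | succ n ih =>
    rcases eq_or_eq_snoc hp with ⟨rfl, rfl⟩ | ⟨q, u, hq, hu, rfl⟩
    · exact h0
    · exact h1 q u v hq hu (ih hq (by simpa using hn))

/-- A node on a path is the end of a path that is an initial segment of it and costs no more. -/
theorem exists_prefix (hlam : ∀ j, 0 < lam j) (hp : p ∈ G.paths s v) :
    ∀ u ∈ p, ∃ q ∈ G.paths s u, q.Sublist p ∧ G.cost lam q ≤ G.cost lam p := by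
  refine mem_paths_induction (P := fun p _ => ∀ u ∈ p, ∃ q ∈ G.paths s u, q.Sublist p ∧
    G.cost lam q ≤ G.cost lam p) ?_ ?_ hp
  · intro u hu
    obtain rfl := List.mem_singleton.1 hu
    exact ⟨_, singleton_mem_paths, List.Sublist.refl _, le_rfl⟩
  · intro p v x hp hx ih u hu
    rcases List.mem_append.1 hu with hu | hu
    · obtain ⟨q, hq, hs, hc⟩ := ih u hu
      refine ⟨q, hq, hs.trans (List.sublist_append_left _ _), hc.trans ?_⟩
      rw [cost_snoc hp.2.1]
      linarith [edgeCost_nonneg hlam hx]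
    · obtain rfl := List.mem_singleton.1 hu
      exact ⟨_, snoc_mem_paths hp hx, List.Sublist.refl _, le_rfl⟩

/-- Removing cycles does not increase the cost. -/
theorem exists_nodup_path (hlam : ∀ j, 0 < lam j) (hp : p ∈ G.paths s v) :
    ∃ q ∈ G.paths s v, q.Nodup ∧ G.cost lam q ≤ G.cost lam p := by
  refine mem_paths_induction (P := fun p v => ∃ q ∈ G.paths s v, q.Nodup ∧
    G.cost lam q ≤ G.cost lam p) ⟨_, singleton_mem_paths, by simp, le_rfl⟩ ?_ hp
  rintro p v u hp hu ⟨q, hq, hn, hc⟩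
  by_cases hm : u ∈ q
  · obtain ⟨r, hr, hs, hrc⟩ := exists_prefix hlam hq u hm
    refine ⟨r, hr, hn.sublist hs, ?_⟩
    rw [cost_snoc hp.2.1]
    linarith [edgeCost_nonneg hlam hu]
  · refine ⟨q ++ [u], snoc_mem_paths hq hu, by simpa using hn.concat hm, ?_⟩
    rw [cost_snoc hp.2.1, cost_snoc hq.2.1]
    linarith

/-- There may be infinitely many paths, but those without repeated nodes are finitely many and
suffice for the minimum. -/
theorem exists_isOptimal [Finite V] (hlam : ∀ j, 0 < lam j) (hne : (G.paths s v).Nonempty) :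
    ∃ o, G.IsOptimal s v lam o := by
  have := Fintype.ofFinite V
  have hfin : {q | q ∈ G.paths s v ∧ q.Nodup}.Finite :=
    (List.finite_length_le V (Fintype.card V)).subset fun q hq => hq.2.length_le_card
  obtain ⟨p, hp⟩ := hne
  obtain ⟨q, hq, hn, -⟩ := exists_nodup_path hlam hp
  obtain ⟨o, ho, hmin⟩ := Set.exists_min_image _ (G.cost lam) hfin ⟨q, hq, hn⟩
  refine ⟨o, ho.1, fun r hr => ?_⟩
  obtain ⟨r', hr', hn', hc⟩ := exists_nodup_path hlam hr
  exact (hmin r' ⟨hr', hn'⟩).trans hc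

theorem IsOptimal.mem_paretoPaths (hlam : ∀ j, 0 < lam j) (h : G.IsOptimal s v lam p) :
    p ∈ G.paretoPaths s v :=
  ⟨h.1, fun q hq hd => (h.2 q hq).not_gt (hd.cost_lt hlam)⟩

theorem IsOptimal.of_snoc (hq : q ∈ G.paths s u) (hu : G.Adj u v)
    (h : G.IsOptimal s v lam (q ++ [v])) : G.IsOptimal s u lam q := by
  refine ⟨hq, fun r hr => ?_⟩
  have := h.2 _ (snoc_mem_paths hr hu)
  rw [cost_snoc hr.2.1, cost_snoc hq.2.1] at this
  linarith

/-! ### Paths of non-null priority -/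

theorem pair_sublist_or {α : Type*} {l : List α} {a b : α} (ha : a ∈ l) (hb : b ∈ l)
    (hab : a ≠ b) : List.Sublist [a, b] l ∨ List.Sublist [b, a] l := by
  induction l with
  | nil => simp at ha
  | cons c l ih =>
    by_cases hac : a = c
    · subst hac
      exact Or.inl ((List.singleton_sublist.2 (List.mem_of_ne_of_mem hab.symm hb)).cons_cons _)
    · have hal := List.mem_of_ne_of_mem hac ha
      by_cases hbc : b = c
      · subst hbc
        exact Or.inr ((List.singleton_sublist.2 hal).cons_cons _)
      · exact (ih hal (List.mem_of_ne_of_mem hbc hb)).imp (fun h => h.cons _) fun h => h.cons _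

section Active

variable {queue popped : List (List V)}

theorem mem_active : p ∈ G.active lam queue popped ↔
    p ∈ queue ∧ G.NonNull lam queue popped p := by
  simp [active]

theorem nodup_active (h : queue.Nodup) : (G.active lam queue popped).Nodup := h.filter _

/-- Of two queued paths with the same end, the more expensive one, or at equal cost the one pushed
later, has null priority. -/
theorem eq_of_mem_active (hp : p ∈ G.active lam queue popped)
    (hq : q ∈ G.active lam queue popped) (h : p.getLast? = q.getLast?) : p = q := by
  rw [mem_active] at hp hq
  by_contra hne
  rcases lt_trichotomy (G.cost lam p) (G.cost lam q) with hc | hc | hc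
  · exact hq.2 ⟨p, hne, h, Or.inl ⟨Or.inl hp.1, hc⟩⟩
  · rcases pair_sublist_or hp.1 hq.1 hne with hs | hs
    · exact hq.2 ⟨p, hne, h, Or.inr (Or.inl ⟨hs, hc⟩)⟩
    · exact hp.2 ⟨q, Ne.symm hne, h.symm, Or.inr (Or.inl ⟨hs, hc.symm⟩)⟩
  · exact hp.2 ⟨q, Ne.symm hne, h.symm, Or.inl ⟨Or.inl hq.1, hc⟩⟩

-- Active paths are determined by their ends. This keeps the heap size at most the number of nodes,
-- however long the queue is.
open scoped Classical in
theorem length_active_le [Finite V] (hn : queue.Nodup) (hq : ∀ p ∈ queue, ∃ v, p ∈ G.paths s v) :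
    (G.active lam queue popped).length ≤ Nat.card V := by
  have := Fintype.ofFinite V
  rw [← List.toFinset_card_of_nodup (nodup_active hn), Nat.card_eq_fintype_card,
    ← Finset.card_univ]
  refine Finset.card_le_card_of_injOn (fun p => p.getLast?.getD s) (fun _ _ => Finset.mem_univ _) ?_
  intro p hp r hr h
  rw [Finset.mem_coe, List.mem_toFinset] at hp hr
  obtain ⟨x, hx⟩ := hq p (mem_active.1 hp).1
  obtain ⟨y, hy⟩ := hq r (mem_active.1 hr).1
  refine eq_of_mem_active hp hr ?_
  have hx := hx.2.1
  have hy := hy.2.1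
  simp only [hx, hy, Option.getD_some] at h
  rw [hx, hy, h]

open scoped Classical in
/-- If the queue contains an optimal path to `v` and none has been popped, then an optimal path
to `v` has a non-null priority. -/
theorem exists_mem_active (hn : queue.Nodup) {c : List V} (hc : c ∈ queue)
    (hcv : c.getLast? = some v)
    (hq : ∀ b ∈ queue, b.getLast? = some v → G.cost lam c ≤ G.cost lam b)
    (hd : ∀ b ∈ popped, b.getLast? = some v → G.cost lam c < G.cost lam b) :
    ∃ a ∈ G.active lam queue popped, G.cost lam a = G.cost lam c := by
  -- The cheapest queued paths to `v`, in order of pushing; the first of them is the witness.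
  set F := queue.filter fun b => b.getLast? = some v ∧ G.cost lam b = G.cost lam c with hF
  have hcF : c ∈ F := by simp [hF, hc, hcv]
  obtain ⟨a, F', hF'⟩ := List.exists_cons_of_ne_nil (List.ne_nil_of_mem hcF)
  have ha : a ∈ F := by simp [hF']
  have ha' : a ∈ queue ∧ a.getLast? = some v ∧ G.cost lam a = G.cost lam c := by
    simpa [hF] using ha
  refine ⟨a, mem_active.2 ⟨ha'.1, ?_⟩, ha'.2.2⟩
  rintro ⟨b, hba, hbv, h⟩
  rw [ha'.2.1] at hbv
  rw [ha'.2.2] at h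
  rcases h with ⟨hb | hb, h⟩ | ⟨hs, h⟩ | ⟨hb, h⟩
  · exact (hq b hb hbv).not_gt h
  · exact (hd b hb hbv).not_gt h
  -- An equally cheap path pushed before `a` would precede the head of `F`, forcing `a` to occur
  -- twice.
  · have h2 := hs.filter fun b => b.getLast? = some v ∧ G.cost lam b = G.cost lam c
    rw [← hF, hF', List.filter_eq_self.2 (by simp [hbv, h, ha'.2])] at h2
    have hnd : (a :: F').Nodup := hF' ▸ hn.filter _
    have h3 : List.Sublist [b, a] F' := by
      cases h2 with
      | cons _ h => exact h
      | cons_cons _ h => exact absurd rfl hba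
    exact (List.nodup_cons.1 hnd).1 (h3.subset (by simp))
  · exact (hd b hb hbv).ne' h

-- Popping `p` changes no other priority: `p` blocks the same paths as popped that it blocked or
-- could newly block in the queue, and any path newly blocked would share its end, hence was not
-- active. So the heap left by the extraction needs no update.
open scoped Classical in
theorem mem_active_pop (hp : p ∈ G.active lam queue popped) :
    q ∈ G.active lam (queue.filter fun b => b ≠ p) (popped ++ [p]) ↔
      q ≠ p ∧ q ∈ G.active lam queue popped := by
  have hpq := (mem_active.1 hp).1
  constructor
  · intro hq
    obtain ⟨hq, hnn⟩ := mem_active.1 hq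
    have hq : q ∈ queue ∧ q ≠ p := by simpa using hq
    refine ⟨hq.2, mem_active.2 ⟨hq.1, ?_⟩⟩
    rintro ⟨b, hbq, hbe, h⟩
    refine hnn ⟨b, hbq, hbe, ?_⟩
    by_cases hbp : b = p
    · subst hbp
      rcases h with ⟨-, h⟩ | ⟨-, h⟩ | ⟨-, h⟩
      · exact Or.inl ⟨by simp, h⟩
      · exact Or.inr (Or.inr ⟨by simp, h⟩)
      · exact Or.inr (Or.inr ⟨by simp, h⟩)
    · rcases h with ⟨hb, h⟩ | ⟨hs, h⟩ | ⟨hb, h⟩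
      · exact Or.inl ⟨by simpa [hbp] using hb, h⟩
      · refine Or.inr (Or.inl ⟨?_, h⟩)
        have := hs.filter fun b => b ≠ p
        rwa [List.filter_eq_self.2 (by simp [hbp, hq.2])] at this
      · exact Or.inr (Or.inr ⟨by simp [hb], h⟩)
  · rintro ⟨hqp, hq⟩
    obtain ⟨hqq, hnn⟩ := mem_active.1 hq
    refine mem_active.2 ⟨by simp [hqq, hqp], ?_⟩
    rintro ⟨b, hbq, hbe, h⟩
    by_cases hbp : b = p
    · subst hbp
      exact hbq (eq_of_mem_active hp hq hbe)
    · refine hnn ⟨b, hbq, hbe, ?_⟩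
      rcases h with ⟨hb, h⟩ | ⟨hs, h⟩ | ⟨hb, h⟩
      · exact Or.inl ⟨by simpa [hbp] using hb, h⟩
      · exact Or.inr (Or.inl ⟨hs.trans List.filter_sublist, h⟩)
      · exact Or.inr (Or.inr ⟨by simpa [hbp] using hb, h⟩)

end Active

open scoped Classical in
theorem isHeap_updateHeap {key : List V → ℝ} {old new : List (List V)} {h : FibForest (List V)}
    (hh : h.IsHeap key (old : Multiset (List V))) (ho : old.Nodup) (hn : new.Nodup) :
    (updateHeap key old new h).IsHeap key (new : Multiset (List V)) := by
  have h1 := (hh.foldl_delete (old.filter fun p => p ∉ new)).foldl_insert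
    (new.filter fun p => p ∉ old)
  -- All lists are duplicate-free, so the identity is checked on multiplicities 0 and 1.
  have h2 : ((new.filter fun p => p ∉ old : List (List V)) : Multiset (List V)) +
      ((old : Multiset (List V)) - (old.filter fun p => p ∉ new : List (List V))) = new := by
    ext a
    have hc (l : List (List V)) (hl : l.Nodup) :
        Multiset.count a (l : Multiset (List V)) = if a ∈ l then 1 else 0 := by
      rw [Multiset.count_eq_of_nodup (Multiset.coe_nodup.2 hl)]; simp only [Multiset.mem_coe]
    rw [Multiset.count_add, Multiset.count_sub]
    rw [hc _ (hn.filter _), hc _ ho, hc _ (ho.filter _), hc _ hn]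
    by_cases h1 : a ∈ old <;> by_cases h2 : a ∈ new <;> simp [h1, h2]
  rw [h2] at h1
  exact h1

end MOG

namespace MOG

variable {V : Type*} {W K : ℕ} {G : MOG V W} {s v : V} {Λ : Fin K → Fin W → ℝ}
  {sample : V → List V} {σ : State V K} {p q : List V}

/-! ### The invariant of an execution -/

open scoped Classical in
/-- The number of paths to `v` in a list. -/
noncomputable def endCount (l : List (List V)) (v : V) : ℕ :=
  l.countP fun p => decide (p.getLast? = some v)

/-- `p` is a discovered path to `v`. -/
def State.Discovers (σ : State V K) (v : V) (p : List V) : Prop :=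
  (p ∈ σ.queue ∨ p ∈ σ.optimalPaths) ∧ p.getLast? = some v

theorem State.mem_discovered : p ∈ σ.discovered v ↔ σ.Discovers v p := by
  simp [State.discovered, State.Discovers]

/-- `p` has been pushed, developed, or generated by the development of its parent. -/
def State.Seen (σ : State V K) (p : List V) : Prop :=
  p ∈ σ.queue ∨ p ∈ σ.developed ∨ p ∈ σ.toScan

/-- The invariant of the executions of IDAQ. -/
structure Inv (G : MOG V W) (Λ : Fin K → Fin W → ℝ) (sample : V → List V) (s : V)
    (σ : State V K) : Prop where
  queue_nodup : σ.queue.Nodup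
  developed_nodup : σ.developed.Nodup
  toScan_nodup : σ.toScan.Nodup
  notMem_developed : ∀ p ∈ σ.queue, p ∉ σ.developed
  notMem_of_toScan : ∀ p ∈ σ.toScan, p ∉ σ.queue ∧ p ∉ σ.developed
  mem_paths : ∀ p, σ.Seen p → ∃ v, p ∈ G.paths s v
  -- Needed so that the extensions of a path being developed for the first time are new.
  parent : ∀ p, σ.Seen p → p = [s] ∨ p.dropLast ∈ σ.developed
  optimalPaths_subset : ∀ p ∈ σ.optimalPaths, p ∈ σ.developed
  -- Required for all `j`, not only the current one, so that it carries over to later iterations.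
  -- The matching path may depend on `j`.
  covered : ∀ v, ∀ q ∈ G.paths s v, q = [s] ∨ q.dropLast ∈ σ.developed →
    q ∈ σ.toScan ∨ G.Dominates (sample v) q ∨
      ∀ j, ∃ c, σ.Discovers v c ∧ G.cost (Λ j) c ≤ G.cost (Λ j) q
  isHeap : σ.heap.IsHeap (G.cost (Λ σ.iter))
    (G.active (Λ σ.iter) σ.queue σ.developed : Multiset (List V))
  pareto : ∀ p ∈ σ.developed, ∀ v, p.getLast? = some v → p ∈ G.paretoPaths s v
  -- One path per iteration, iterations being counted from 0; the second half says that the current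
  -- iteration has not used its turn at `v`.
  count_le : ∀ v, endCount σ.developed v ≤ σ.iter + 1 ∧
    ((∀ b ∈ σ.developed, ¬ G.IsOptimal s v (Λ σ.iter) b) → endCount σ.developed v ≤ σ.iter)
  time_le : (σ.developTime : ℝ) ≤ (15 * Real.log (Nat.card V) + 2) * σ.developed.length

theorem inv_initState (hK : 0 < K) : Inv G Λ sample s (initState s hK) where
  queue_nodup := by simp [initState]
  developed_nodup := by simp [initState]
  toScan_nodup := by simp [initState]
  notMem_developed := by simp [initState]
  notMem_of_toScan := by simp [initState]
  mem_paths := by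
    intro p hp
    simp only [State.Seen, initState, List.mem_singleton, List.not_mem_nil, or_false] at hp
    exact ⟨s, hp ▸ singleton_mem_paths⟩
  parent := by
    intro p hp
    simpa [State.Seen, initState] using hp
  optimalPaths_subset := by simp [initState]
  covered := by
    intro v q hq h
    simp only [initState, List.not_mem_nil, or_false] at h
    subst h
    exact Or.inr (Or.inr fun j => ⟨[s], ⟨by simp [initState], hq.2.1⟩, le_rfl⟩)
  isHeap := by
    have h : G.active (Λ (initState s hK).iter) [[s]] [] = [[s]] := by
      classical
      refine List.filter_eq_self.2 ?_
      intro a ha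
      obtain rfl := List.mem_singleton.1 ha
      simp only [decide_eq_true_eq]
      rintro ⟨b, hb, -, h | h | h⟩
      · simp [hb] at h
      · simpa using h.1.length_le
      · simp at h
    simp only [initState] at h ⊢
    rw [h]
    exact FibForest.isHeap_nil.insert [s]
  pareto := by simp [initState]
  count_le := by simp [initState, endCount]
  time_le := by simp [initState]

/-- The path that is popped is optimal for the current coefficient vector. -/
theorem Inv.isOptimal [Finite V] (hI : Inv G Λ sample s σ) (hΛ : ∀ i j, 0 < Λ i j)
    (hsample : ∀ v, sample v ∈ G.paths s v) (hscan : σ.toScan = [])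
    (hp : p ∈ G.active (Λ σ.iter) σ.queue σ.developed)
    (hmin : ∀ q ∈ G.active (Λ σ.iter) σ.queue σ.developed,
      G.cost (Λ σ.iter) p ≤ G.cost (Λ σ.iter) q)
    (hv : p ∈ G.paths s v) : G.IsOptimal s v (Λ σ.iter) p := by
  have hlam := hΛ σ.iter
  -- Any optimal path cheaper than `p` is matched by a developed path.
  have key : ∀ o u, o ∈ G.paths s u → G.IsOptimal s u (Λ σ.iter) o →
      G.cost (Λ σ.iter) o < G.cost (Λ σ.iter) p →
      ∃ b ∈ σ.developed, b ∈ G.paths s u ∧ G.cost (Λ σ.iter) b ≤ G.cost (Λ σ.iter) o := by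
    -- The case where the parent is developed. A sample path cannot dominate an optimal `q`, so some
    -- discovered `c` matches it. If no developed path did, `c` would be in the queue and an active
    -- path of the same cost would undercut the minimum `p`.
    have main : ∀ q u, G.IsOptimal s u (Λ σ.iter) q →
        (q = [s] ∨ q.dropLast ∈ σ.developed) → G.cost (Λ σ.iter) q < G.cost (Λ σ.iter) p →
        ∃ b ∈ σ.developed, b ∈ G.paths s u ∧ G.cost (Λ σ.iter) b ≤ G.cost (Λ σ.iter) q := by
      intro q u hopt hq hlt
      by_contra! hno
      have hend (b : List V) (hb : σ.Seen b) (hbu : b.getLast? = some u) : b ∈ G.paths s u := by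
        obtain ⟨x, hx⟩ := hI.mem_paths b hb
        obtain rfl : u = x := by simpa [hbu] using hx.2.1
        exact hx
      rcases hI.covered u q hopt.1 hq with h | h | h
      · simp [hscan] at h
      · exact (hopt.2 _ (hsample u)).not_gt (h.cost_lt hlam)
      · obtain ⟨c, ⟨hc, hcu⟩, hcq⟩ := h σ.iter
        rcases hc with hc | hc
        · obtain ⟨a, ha, hac⟩ := exists_mem_active (popped := σ.developed) hI.queue_nodup hc hcu
            (fun b hb hbu => hcq.trans (hopt.2 b (hend b (Or.inl hb) hbu)))
            (fun b hb hbu => hcq.trans_lt (hno b hb (hend b (Or.inr (Or.inl hb)) hbu)))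
          have := hmin a ha
          linarith
        · have hc := hI.optimalPaths_subset c hc
          exact (hno c hc (hend c (Or.inr (Or.inl hc)) hcu)).not_ge hcq
    intro o u ho
    refine mem_paths_induction (P := fun o u => G.IsOptimal s u (Λ σ.iter) o →
      G.cost (Λ σ.iter) o < G.cost (Λ σ.iter) p →
      ∃ b ∈ σ.developed, b ∈ G.paths s u ∧ G.cost (Λ σ.iter) b ≤ G.cost (Λ σ.iter) o) ?_ ?_ ho
    · intro hopt
      exact main _ _ hopt (Or.inl rfl)
    · intro o x u ho hu ih hopt hlt
      have hc := cost_snoc (lam := Λ σ.iter) ho.2.1 u (G := G)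
      have hn := edgeCost_nonneg hlam hu
      obtain ⟨b, hb, hbx, hbo⟩ := ih (hopt.of_snoc ho hu) (by linarith)
      have hcb := cost_snoc (lam := Λ σ.iter) hbx.2.1 u (G := G)
      -- The parent `o` itself may never have been developed, so it is exchanged for the developed
      -- `b`, to whose extension `main` applies.
      have hbopt : G.IsOptimal s u (Λ σ.iter) (b ++ [u]) :=
        ⟨snoc_mem_paths hbx hu, fun r hr => le_trans (by linarith) (hopt.2 r hr)⟩
      obtain ⟨d, hd, hdu, hdc⟩ := main _ _ hbopt (Or.inr (by simpa using hb)) (by linarith)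
      exact ⟨d, hd, hdu, by linarith⟩
  obtain ⟨o, ho⟩ := exists_isOptimal hlam ⟨p, hv⟩
  refine ⟨hv, fun r hr => le_trans ?_ (ho.2 r hr)⟩
  by_contra! hlt
  obtain ⟨b, hb, hbv, hbo⟩ := key o v ho.1 ho hlt
  -- A strictly cheaper developed path to `v` makes the priority of `p` null.
  refine (mem_active.1 hp).2 ⟨b, ?_, by rw [hbv.2.1, hv.2.1], Or.inl ⟨Or.inr hb, by linarith⟩⟩
  rintro rfl
  exact hI.notMem_developed b (mem_active.1 hp).1 hb

/-- Only the heap and the count depend on the iteration, and the old bound `σ.iter + 1` is the new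
`i`, so both halves of the count follow from its first half. -/
theorem Inv.adapt (hI : Inv G Λ sample s σ) {i : Fin K} (hi : (i : ℕ) = σ.iter + 1) :
    Inv G Λ sample s (adaptState G Λ σ i) :=
  { hI with
    isHeap := by
      have := FibForest.isHeap_nil.foldl_insert (key := G.cost (Λ i))
        (G.active (Λ i) σ.queue σ.developed)
      rwa [add_zero] at this
    count_le := fun v => by
      have := (hI.count_le v).1
      simp only [adaptState]
      omega }

/-- A path that is discarded is dominated or at least as expensive as discovered paths. -/
theorem Inv.discard (hI : Inv G Λ sample s σ) {rest : List (List V)}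
    (hscan : σ.toScan = q :: rest)
    (hcov : ∀ v, q.getLast? = some v → G.Dominates (sample v) q ∨
      ∀ j, ∃ c, σ.Discovers v c ∧ G.cost (Λ j) c ≤ G.cost (Λ j) q) :
    Inv G Λ sample s { σ with toScan := rest } :=
  { hI with
    toScan_nodup := (List.nodup_cons.1 (hscan ▸ hI.toScan_nodup)).2
    notMem_of_toScan := fun p hp => hI.notMem_of_toScan p (by simp [hscan, show p ∈ rest from hp])
    mem_paths := fun p hp => hI.mem_paths p
      (hp.imp id (Or.imp id fun h => by simp [hscan, show p ∈ rest from h]))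
    parent := fun p hp => hI.parent p
      (hp.imp id (Or.imp id fun h => by simp [hscan, show p ∈ rest from h]))
    covered := fun v r hr h => by
      rcases hI.covered v r hr h with h | h
      · rw [hscan] at h
        rcases List.mem_cons.1 h with rfl | h
        · exact Or.inr (hcov v hr.2.1)
        · exact Or.inl h
      · exact Or.inr h }

theorem Irrelevant.exists_le (hΛ : ∀ i j, 0 < Λ i j) (h : G.Irrelevant Λ (σ.discovered v) q)
    (j : Fin K) : ∃ c, σ.Discovers v c ∧ G.cost (Λ j) c ≤ G.cost (Λ j) q := by
  unfold Irrelevant at h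
  split_ifs at h
  · obtain ⟨b, hb, hd⟩ := h
    exact ⟨b, State.mem_discovered.1 hb, (hd.cost_lt (hΛ j)).le⟩
  · obtain ⟨best, hbest, hle⟩ := h
    exact ⟨best j, State.mem_discovered.1 (hbest j).1, hle j⟩

/-- The paths removed by Is-Relevant are no cheaper than paths that are kept or pushed. -/
theorem Relevant.exists_le (hΛ : ∀ i j, 0 < Λ i j) {Q R : Finset (List V)}
    (h : G.Relevant Λ Q q R) (j : Fin K) {c : List V} (hc : c ∈ Q) :
    ∃ d, (d = q ∨ d ∈ Q ∧ d ∉ R) ∧ G.cost (Λ j) d ≤ G.cost (Λ j) c := by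
  classical
  unfold Relevant at h
  split_ifs at h
  · obtain ⟨-, rfl⟩ := h
    by_cases hd : G.Dominates q c
    · exact ⟨q, Or.inl rfl, (hd.cost_lt (hΛ j)).le⟩
    · exact ⟨c, Or.inr ⟨hc, by simp [hd]⟩, le_rfl⟩
  · obtain ⟨best, hbest, -, rfl⟩ := h
    by_cases hlt : G.cost (Λ j) q < G.cost (Λ j) (best j)
    · exact ⟨q, Or.inl rfl, hlt.le.trans ((hbest j).2 c hc)⟩
    -- The path `best j` is not replaced at index `j`, which protects it from removal.
    · refine ⟨best j, Or.inr ⟨(hbest j).1, fun hm => ?_⟩, (hbest j).2 c hc⟩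
      exact (Finset.mem_filter.1 hm).2 j (by rw [if_neg hlt])

theorem Relevant.subset {Q R : Finset (List V)} (h : G.Relevant Λ Q q R) : R ⊆ Q := by
  classical
  unfold Relevant at h
  split_ifs at h
  · obtain ⟨-, rfl⟩ := h
    exact Finset.filter_subset _ _
  · obtain ⟨best, -, -, rfl⟩ := h
    exact Finset.filter_subset _ _

theorem Inv.push (hI : Inv G Λ sample s σ) (hΛ : ∀ i j, 0 < Λ i j) {rest : List (List V)}
    {R : Finset (List V)} (hscan : σ.toScan = q :: rest) (hv : q.getLast? = some v)
    (hrel : G.Relevant Λ (σ.discovered v) q R) :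
    Inv G Λ sample s (pushState G Λ σ q rest R) := by
  classical
  have hq := hI.notMem_of_toScan q (by simp [hscan])
  have hnd := List.nodup_cons.1 (hscan ▸ hI.toScan_nodup)
  have hqueue (p : List V) (hp : p ∈ (pushState G Λ σ q rest R).queue) :
      p ∈ σ.queue ∨ p = q := by
    simp only [pushState, List.mem_append, List.mem_filter, List.mem_singleton] at hp
    exact hp.imp And.left id
  have hseen (p : List V) (hp : (pushState G Λ σ q rest R).Seen p) : σ.Seen p := by
    rcases hp with hp | hp | hp
    · rcases hqueue p hp with hp | rfl
      · exact Or.inl hp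
      · exact Or.inr (Or.inr (by simp [hscan]))
    · exact Or.inr (Or.inl hp)
    · exact Or.inr (Or.inr (by simp [hscan, show p ∈ rest from hp]))
  have hnodup : (pushState G Λ σ q rest R).queue.Nodup := by
    refine List.nodup_append.2 ⟨hI.queue_nodup.filter _, by simp, ?_⟩
    intro a ha b hb
    obtain rfl := List.mem_singleton.1 hb
    rintro rfl
    exact hq.1 (List.mem_filter.1 ha).1
  have hnew : (pushState G Λ σ q rest R).Discovers v q := ⟨Or.inl (by simp [pushState]), hv⟩
  have hkeep {u : V} {c : List V} (hc : σ.Discovers u c) (hR : c ∉ R) :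
      (pushState G Λ σ q rest R).Discovers u c :=
    ⟨hc.1.imp (fun h => by simp [pushState, h, hR]) (fun h => by simp [pushState, h, hR]), hc.2⟩
  exact
  { queue_nodup := hnodup
    developed_nodup := hI.developed_nodup
    toScan_nodup := hnd.2
    notMem_developed := fun p hp => (hqueue p hp).elim (hI.notMem_developed p) fun h => h ▸ hq.2
    notMem_of_toScan := fun p hp => by
      have hp : p ∈ rest := hp
      have h := hI.notMem_of_toScan p (by simp [hscan, hp])
      refine ⟨fun h' => ?_, h.2⟩
      rcases hqueue p h' with h' | rfl
      exacts [h.1 h', hnd.1 hp]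
    mem_paths := fun p hp => hI.mem_paths p (hseen p hp)
    parent := fun p hp => hI.parent p (hseen p hp)
    optimalPaths_subset := fun p hp => hI.optimalPaths_subset p (List.mem_filter.1 hp).1
    covered := fun u r hr h => by
      rcases hI.covered u r hr h with h | h | h
      · rw [hscan] at h
        rcases List.mem_cons.1 h with rfl | h
        · obtain rfl : v = u := by simpa [hv] using hr.2.1
          exact Or.inr (Or.inr fun j => ⟨r, hnew, le_rfl⟩)
        · exact Or.inl h
      · exact Or.inr (Or.inl h)
      · refine Or.inr (Or.inr fun j => ?_)
        obtain ⟨c, hc, hcr⟩ := h j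
        -- If the matching path is removed, a kept path or `q` takes over for this `j`.
        by_cases hR : c ∈ R
        · have hcv := hrel.subset hR
          obtain rfl : v = u := by
            simpa [(State.mem_discovered.1 hcv).2] using hc.2
          obtain ⟨d, hd, hdc⟩ := hrel.exists_le hΛ j hcv
          refine ⟨d, ?_, hdc.trans hcr⟩
          rcases hd with rfl | ⟨hd, hdR⟩
          · exact hnew
          · exact hkeep (State.mem_discovered.1 hd) hdR
        · exact ⟨c, hkeep hc hR, hcr⟩
    isHeap := isHeap_updateHeap hI.isHeap (nodup_active hI.queue_nodup) (nodup_active hnodup)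
    pareto := hI.pareto
    count_le := hI.count_le
    time_le := hI.time_le }

theorem Inv.develop [Finite V] (hI : Inv G Λ sample s σ) (hΛ : ∀ i j, 0 < Λ i j)
    (hsample : ∀ v, sample v ∈ G.paths s v) {h : FibForest (List V)} {steps : ℕ} {nbrs : List V}
    (hscan : σ.toScan = [])
    (hpop : σ.heap.extractMin (G.cost (Λ σ.iter)) = some (p, h, steps))
    (hv : p.getLast? = some v) (hnodup : nbrs.Nodup) (hnbrs : ∀ u, u ∈ nbrs ↔ G.Adj v u) :
    Inv G Λ sample s (popState σ p h steps (nbrs.map fun u => p ++ [u])) := by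
  classical
  obtain ⟨he, hod, hwf⟩ := hI.isHeap
  obtain ⟨e, wf, od⟩ := FibForest.extractMin_spec hpop
  have hpa : p ∈ G.active (Λ σ.iter) σ.queue σ.developed := by
    rw [← Multiset.mem_coe, ← he, e]; simp
  have hpq := (mem_active.1 hpa).1
  have hpd := hI.notMem_developed p hpq
  have hpv : p ∈ G.paths s v := by
    obtain ⟨x, hx⟩ := hI.mem_paths p (Or.inl hpq)
    obtain rfl : v = x := by simpa [hv] using hx.2.1
    exact hx
  have hopt := hI.isOptimal hΛ hsample hscan hpa
    (fun q hq => (od hod).2 q (by rw [he]; exact hq)) hpv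
  -- Since `p` has non-null priority, the current iteration has not yet used its turn at `v`.
  have hnone : ∀ b ∈ σ.developed, ¬ G.IsOptimal s v (Λ σ.iter) b := by
    intro b hb hbo
    have hbp : b ≠ p := by rintro rfl; exact hpd hb
    refine (mem_active.1 hpa).2 ⟨b, hbp, by rw [hv, hbo.1.2.1], ?_⟩
    rcases (hbo.2 p hpv).lt_or_eq with hlt | heq
    · exact Or.inl ⟨Or.inr hb, hlt⟩
    · exact Or.inr (Or.inr ⟨hb, heq⟩)
  have hne : p ≠ [] := by rintro rfl; simp at hv
  have hext {r : List V} (hr : r ∈ nbrs.map fun u => p ++ [u]) :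
      ∃ u, G.Adj v u ∧ r = p ++ [u] := by
    obtain ⟨u, hu, rfl⟩ := List.mem_map.1 hr
    exact ⟨u, (hnbrs u).1 hu, rfl⟩
  have hfresh {u : V} : ¬ σ.Seen (p ++ [u]) := by
    intro hs
    rcases hI.parent _ hs with h | h
    · have := congrArg List.length h
      simp [hne] at this
    · exact hpd (by simpa using h)
  have hqueue {r : List V} (hr : r ∈ (popState σ p h steps (nbrs.map fun u => p ++ [u])).queue) :
      r ∈ σ.queue ∧ r ≠ p := by simpa [popState] using hr
  have hdev {r : List V} :
      r ∈ (popState σ p h steps (nbrs.map fun u => p ++ [u])).developed ↔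
        r ∈ σ.developed ∨ r = p := by simp [popState]
  have hcount (u : V) : endCount (popState σ p h steps (nbrs.map fun u => p ++ [u])).developed u =
      endCount σ.developed u + if u = v then 1 else 0 := by
    simp [popState, endCount, List.countP_append, List.countP_cons, hv, eq_comm]
  have hseen {r : List V} (hr : (popState σ p h steps (nbrs.map fun u => p ++ [u])).Seen r) :
      σ.Seen r ∨ ∃ u, G.Adj v u ∧ r = p ++ [u] := by
    rcases hr with hr | hr | hr
    · exact Or.inl (Or.inl (hqueue hr).1)
    · rcases hdev.1 hr with hr | rfl
      · exact Or.inl (Or.inr (Or.inl hr))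
      · exact Or.inl (Or.inl hpq)
    · exact Or.inr (hext hr)
  exact
  { queue_nodup := hI.queue_nodup.filter _
    developed_nodup := by
      refine List.nodup_append.2 ⟨hI.developed_nodup, by simp, ?_⟩
      intro a ha b hb
      obtain rfl := List.mem_singleton.1 hb
      rintro rfl
      exact hpd ha
    toScan_nodup := hnodup.map fun a b hab => by simpa using hab
    notMem_developed := fun r hr h => (hdev.1 h).elim
      (hI.notMem_developed r (hqueue hr).1) (hqueue hr).2
    notMem_of_toScan := fun r hr => by
      obtain ⟨u, -, rfl⟩ := hext hr
      refine ⟨fun h => hfresh (Or.inl (hqueue h).1), fun h => ?_⟩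
      rcases hdev.1 h with h | h
      · exact hfresh (Or.inr (Or.inl h))
      · simp at h
    mem_paths := fun r hr => by
      rcases hseen hr with hr | ⟨u, hu, rfl⟩
      · exact hI.mem_paths r hr
      · exact ⟨u, snoc_mem_paths hpv hu⟩
    parent := fun r hr => by
      rcases hseen hr with hr | ⟨u, hu, rfl⟩
      · exact (hI.parent r hr).imp id fun h => hdev.2 (Or.inl h)
      · exact Or.inr (hdev.2 (Or.inr (by simp)))
    optimalPaths_subset := fun r hr => by
      rcases List.mem_append.1 (show r ∈ σ.optimalPaths ++ [p] from hr) with hr | hr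
      · exact hdev.2 (Or.inl (hI.optimalPaths_subset r hr))
      · exact hdev.2 (Or.inr (by simpa using hr))
    covered := fun u r hr hc => by
      have hold (hc : r = [s] ∨ r.dropLast ∈ σ.developed) :
          G.Dominates (sample u) r ∨
            ∀ j, ∃ c, (popState σ p h steps (nbrs.map fun u => p ++ [u])).Discovers u c ∧
              G.cost (Λ j) c ≤ G.cost (Λ j) r := by
        rcases hI.covered u r hr hc with hc | hc | hc
        · simp [hscan] at hc
        · exact Or.inl hc
        · refine Or.inr fun j => ?_
          obtain ⟨c, hc, hcr⟩ := hc j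
          refine ⟨c, ⟨?_, hc.2⟩, hcr⟩
          by_cases hcp : c = p
          · exact Or.inr (by simp [popState, hcp])
          · exact hc.1.imp (fun h => by simp [popState, h, hcp]) fun h => by simp [popState, h]
      rcases hc with hc | hc
      · exact Or.inr (hold (Or.inl hc))
      rcases hdev.1 hc with hc | hc
      · exact Or.inr (hold (Or.inr hc))
      -- Paths whose parent is `p` are exactly those about to be scanned.
      · rcases eq_or_eq_snoc hr with ⟨rfl, -⟩ | ⟨q, x, hq, hx, rfl⟩
        · exact absurd hc.symm (by simpa using hne)
        · obtain rfl : q = p := by simpa using hc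
          obtain rfl : v = x := by simpa [hv] using hq.2.1
          exact Or.inl (List.mem_map.2 ⟨u, (hnbrs u).2 hx, rfl⟩)
    isHeap := by
      refine ⟨?_, (od hod).1, wf hwf⟩
      have hnd : (p ::ₘ h.elems).Nodup := by
        rw [← e, he]
        exact Multiset.coe_nodup.2 (nodup_active hI.queue_nodup)
      have hnd' := Multiset.nodup_cons.1 hnd
      refine (Multiset.Nodup.ext hnd'.2
        (Multiset.coe_nodup.2 (nodup_active (hI.queue_nodup.filter _)))).2 fun r => ?_
      have h1 : r ∈ G.active (Λ σ.iter) σ.queue σ.developed ↔ r = p ∨ r ∈ h.elems := by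
        rw [← Multiset.mem_coe, ← he, e, Multiset.mem_cons]
      refine Iff.trans ?_ (mem_active_pop hpa).symm
      rw [h1]
      constructor
      · intro hr
        exact ⟨by rintro rfl; exact hnd'.1 hr, Or.inr hr⟩
      · rintro ⟨h1, h2⟩
        exact h2.resolve_left h1
    pareto := fun r hr u hu => by
      rcases hdev.1 hr with hr | rfl
      · exact hI.pareto r hr u hu
      · obtain rfl : v = u := by simpa [hv] using hu
        exact hopt.mem_paretoPaths (hΛ _)
    count_le := fun u => by
      rw [hcount]
      have h1 := hI.count_le u
      change endCount σ.developed u + _ ≤ (σ.iter : ℕ) + 1 ∧ (_ → _ ≤ (σ.iter : ℕ))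
      by_cases huv : u = v
      · subst huv
        have := h1.2 hnone
        simp only [if_true]
        exact ⟨by omega, fun h => absurd hopt (h p (hdev.2 (Or.inr rfl)))⟩
      · simp only [huv, if_false, add_zero]
        exact ⟨h1.1, fun h => h1.2 fun b hb => h b (hdev.2 (Or.inl hb))⟩
    time_le := by
      have h1 := FibForest.extractMin_amortized_le (n := Nat.card V) hpop hwf (by
        rw [he]
        exact length_active_le hI.queue_nodup fun r hr => hI.mem_paths r (Or.inl hr))
      have h2 := hI.time_le
      simp only [popState, List.length_append, List.length_singleton]
      push_cast
      linarith }

theorem Reachable.inv [Finite V] {hK : 0 < K} (hΛ : ∀ i j, 0 < Λ i j)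
    (hsample : ∀ v, sample v ∈ G.paths s v) (h : G.Reachable Λ sample s hK σ) :
    Inv G Λ sample s σ := by
  induction h with
  | refl => exact inv_initState hK
  | tail _ hstep hI =>
    cases hstep with
    | adapt i hscan hempty hi => exact hI.adapt hi
    | develop p v h steps nbrs hscan hpop hv hnodup hnbrs =>
      exact hI.develop hΛ hsample hscan hpop hv hnodup hnbrs
    | scanDominated q v rest hscan hv hdom =>
      refine hI.discard hscan fun u hu => Or.inl ?_
      obtain rfl : v = u := by simpa [hv] using hu
      exact hdom
    | scanIrrelevant q v rest hscan hv hdom hirr =>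
      refine hI.discard hscan fun u hu => Or.inr ?_
      obtain rfl : v = u := by simpa [hv] using hu
      exact hirr.exists_le hΛ
    | scanRelevant q v rest R hscan hv hdom hrel => exact hI.push hΛ hscan hv hrel

/-! ### Counting the developed paths -/

theorem Inv.endCount_le (hI : Inv G Λ sample s σ) (v : V) : endCount σ.developed v ≤ K :=
  (hI.count_le v).1.trans σ.iter.2

/-- The developed paths to `v` are Pareto and pairwise distinct. -/
theorem Inv.endCount_le_of_mem_lNodes (hI : Inv G Λ sample s σ) {l : ℕ} (hv : v ∈ G.lNodes s l) :
    endCount σ.developed v ≤ l := by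
  classical
  have hnd : (σ.developed.filter fun p => p.getLast? = some v).Nodup :=
    hI.developed_nodup.filter _
  have hsub : (((σ.developed.filter fun p => p.getLast? = some v).toFinset : Finset (List V)) :
      Set (List V)) ⊆ G.paretoPaths s v := by
    intro p hp
    simp only [List.coe_toFinset, Set.mem_ofPred_eq, List.mem_filter, decide_eq_true_eq] at hp
    exact hI.pareto p hp.1 v hp.2
  have h1 := (Set.encard_le_encard hsub).trans hv
  rw [Set.encard_coe_eq_coe_finsetCard, List.toFinset_card_of_nodup hnd] at h1
  have h2 : endCount σ.developed v = (σ.developed.filter fun p => p.getLast? = some v).length := by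
    unfold endCount
    rw [List.countP_eq_length_filter]
  rw [h2]
  exact_mod_cast h1

theorem sum_endCount [Fintype V] {l : List (List V)} (hl : ∀ p ∈ l, p ≠ []) :
    ∑ v, endCount l v = l.length := by
  classical
  induction l with
  | nil => simp [endCount]
  | cons p l ih =>
    have ih := ih fun q hq => hl q (List.mem_cons_of_mem _ hq)
    have hp := List.getLast?_eq_some_getLast (hl p List.mem_cons_self)
    have h (v : V) : endCount (p :: l) v =
        endCount l v + if p.getLast (hl p List.mem_cons_self) = v then 1 else 0 := by
      simp [endCount, List.countP_cons, hp]
    simp_rw [h]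
    rw [Finset.sum_add_distrib, ih]
    simp

/-- Every node has an optimal, hence Pareto, path, so there are no `0`-nodes, whereas `1 - log n /
n` is positive. -/
theorem IsL.pos [Finite V] {L : ℕ} (hlam : ∃ lam : Fin W → ℝ, ∀ j, 0 < lam j)
    (hne : ∀ v, (G.paths s v).Nonempty) (hL : G.IsL s L) : 1 ≤ L := by
  obtain ⟨lam, hlam⟩ := hlam
  by_contra h0
  obtain rfl : L = 0 := by omega
  have hempty : G.lNodes s 0 = ∅ := by
    refine Set.eq_empty_of_forall_notMem fun v hv => ?_
    obtain ⟨o, ho⟩ := exists_isOptimal hlam (hne v)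
    have h1 : G.paretoPaths s v = ∅ := by simpa [lNodes] using hv
    exact Set.notMem_empty o (h1 ▸ ho.mem_paretoPaths hlam)
  have h1 : 1 - Real.log (Nat.card V) / Nat.card V ≤ G.lRatio s 0 := hL.1
  have hpos : (0 : ℝ) < Nat.card V := by
    have : Nonempty V := ⟨s⟩
    exact_mod_cast Nat.card_pos
  rw [lRatio, hempty] at h1
  have h2 := Real.log_le_sub_one_of_pos hpos
  have h3 : Real.log (Nat.card V) / Nat.card V < 1 := by
    rw [div_lt_one hpos]; linarith
  simp at h1
  linarith

theorem ncard_compl_lNodes_le [Finite V] {L : ℕ} (hL : G.IsL s L) :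
    ((G.lNodes s L)ᶜ.ncard : ℝ) ≤ Real.log (Nat.card V) := by
  have h1 : 1 - Real.log (Nat.card V) / Nat.card V ≤ G.lRatio s L := hL.1
  have hpos : (0 : ℝ) < Nat.card V := by
    have : Nonempty V := ⟨s⟩
    exact_mod_cast Nat.card_pos
  have h2 : ((G.lNodes s L).ncard : ℝ) + ((G.lNodes s L)ᶜ.ncard : ℝ) = Nat.card V := by
    exact_mod_cast Set.ncard_add_ncard_compl _
  rw [lRatio, sub_le_iff_le_add, ← add_div, le_div_iff₀ hpos] at h1
  linarith

theorem Inv.length_developed_le [Finite V] (hI : Inv G Λ sample s σ) {L : ℕ} (hL : G.IsL s L) :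
    (σ.developed.length : ℝ) ≤ L * Nat.card V + K * Real.log (Nat.card V) := by
  classical
  have := Fintype.ofFinite V
  have hne : ∀ p ∈ σ.developed, p ≠ [] := by
    rintro p hp rfl
    obtain ⟨v, hv⟩ := hI.mem_paths [] (Or.inr (Or.inl hp))
    simpa using hv.1
  have h1 : ∀ v, endCount σ.developed v ≤ L + if v ∈ (G.lNodes s L)ᶜ then K else 0 := by
    intro v
    by_cases hv : v ∈ G.lNodes s L
    · exact (hI.endCount_le_of_mem_lNodes hv).trans (Nat.le_add_right _ _)
    · rw [if_pos (Set.mem_compl hv)]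
      exact (hI.endCount_le v).trans (Nat.le_add_left _ _)
  have h2 : σ.developed.length ≤ L * Nat.card V + K * (G.lNodes s L)ᶜ.ncard := by
    rw [← sum_endCount hne]
    refine (Finset.sum_le_sum fun v _ => h1 v).trans (le_of_eq ?_)
    rw [Finset.sum_add_distrib, Finset.sum_const, ← Finset.sum_filter, Finset.sum_const,
      Set.ncard_eq_toFinset_card', Finset.card_univ, Nat.card_eq_fintype_card]
    simp only [smul_eq_mul, mul_comm]
    congr 3
    ext v
    simp
  calc (σ.developed.length : ℝ) ≤ L * Nat.card V + K * (G.lNodes s L)ᶜ.ncard := by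
        exact_mod_cast h2
    _ ≤ _ := by
        gcongr
        exact ncard_compl_lNodes_le hL

end MOG

/-! ### The final bounds -/

theorem log_le_two_mul_sqrt {x : ℝ} (hx : 0 < x) : Real.log x ≤ 2 * Real.sqrt x := by
  have h := Real.log_le_sub_one_of_pos (Real.sqrt_pos.2 hx)
  rw [Real.log_sqrt hx.le] at h
  linarith

theorem mainTheorem8 (cK : ℝ) :
    ∃ C : ℝ, 0 < C ∧
      ∀ (V : Type*) [Finite V] (W K : ℕ) (_ : 0 < W) (hK : 0 < K) (G : MOG V W) (s : V)
        (Λ : Fin K → Fin W → ℝ) (L : ℕ) (sample : V → List V),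
        (∀ v, (G.paths s v).Nonempty) →
        (∀ i j, 0 < Λ i j) →
        (K : ℝ) ≤ cK * Real.sqrt (Nat.card V) →
        G.IsL s L →
        (∀ v, G.IsOptimal s v (Λ ⟨0, hK⟩) (sample v)) →
        ∀ σ : MOG.State V K, G.Reachable Λ sample s hK σ →
          (σ.developed.length : ℝ) ≤ C * (L * Nat.card V) ∧
          (2 ≤ Nat.card V →
            (σ.developTime : ℝ) ≤ C * (L * Nat.card V * Real.log (Nat.card V))) ∧
          (2 ≤ Nat.card V → ∀ (F : ℕ → ℝ) (cF : ℝ), (L : ℝ) ≤ cF * F (Nat.card V) →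
            (σ.developTime : ℝ) ≤
              C * cF * (F (Nat.card V) * Nat.card V * Real.log (Nat.card V))) := by
  have hB : 0 < 1 + 2 * |cK| := by positivity
  -- The path count carries the factor `1 + 2 * |cK|`. For `n ≥ 2`, `log n ≥ 1/2` gives `15 * log n
  -- + 2 ≤ 19 * log n`.
  refine ⟨19 * (1 + 2 * |cK|), by positivity, ?_⟩
  intro V _ W K _ hK G s Λ L sample hne hΛ hKle hL hsample σ hσ
  have hI := hσ.inv hΛ fun v => (hsample v).1
  have hLpos : (1 : ℝ) ≤ L := by exact_mod_cast hL.pos ⟨_, hΛ ⟨0, hK⟩⟩ hne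
  have hcard : 0 < Nat.card V := by
    have : Nonempty V := ⟨s⟩
    exact Nat.card_pos
  have hlen := hI.length_developed_le hL
  have htime := hI.time_le
  generalize Nat.card V = n at *
  have hn : (1 : ℝ) ≤ n := by exact_mod_cast hcard
  have hlog0 : 0 ≤ Real.log n := Real.log_nonneg hn
  -- The two factors `√n` multiply to `n`, and `1 ≤ L` absorbs the result into `L * n`.
  have hKlog : K * Real.log n ≤ 2 * |cK| * (L * n) := by
    calc K * Real.log n ≤ (|cK| * Real.sqrt n) * (2 * Real.sqrt n) := by
          refine mul_le_mul (hKle.trans ?_) (log_le_two_mul_sqrt (by linarith)) hlog0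
            (by positivity)
          exact mul_le_mul_of_nonneg_right (le_abs_self cK) (Real.sqrt_nonneg _)
      _ = 2 * |cK| * (1 * n) := by
          linear_combination (2 * |cK|) * Real.mul_self_sqrt (show (0 : ℝ) ≤ n by linarith)
      _ ≤ 2 * |cK| * (L * n) := by gcongr
  have h1 : (σ.developed.length : ℝ) ≤ (1 + 2 * |cK|) * (L * n) := by linarith
  have hLn : 0 ≤ (1 + 2 * |cK|) * (L * n) := by positivity
  have h2 (h2n : 2 ≤ n) :
      (σ.developTime : ℝ) ≤ 19 * (1 + 2 * |cK|) * (L * n * Real.log n) := by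
    have hlog : 1 / 2 ≤ Real.log n := by
      have := Real.log_le_log (by norm_num) (show (2 : ℝ) ≤ n by exact_mod_cast h2n)
      linarith [Real.log_two_gt_d9]
    calc (σ.developTime : ℝ) ≤ (15 * Real.log n + 2) * σ.developed.length := htime
      _ ≤ (19 * Real.log n) * ((1 + 2 * |cK|) * (L * n)) :=
          mul_le_mul (by linarith) h1 (by positivity) (by positivity)
      _ = _ := by ring
  refine ⟨by linarith, h2, fun h2n F cF hF => (h2 h2n).trans ?_⟩
  calc 19 * (1 + 2 * |cK|) * (L * n * Real.log n)
      ≤ 19 * (1 + 2 * |cK|) * (cF * F n * n * Real.log n) := by gcongr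
    _ = _ := by ring
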